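/- **Theorem (Subject Reduction).** Let $\mathcal S$ be a commutative ring. Consider the calculus $\lambda^{vec}_R$ over $\mathcal S$, given as follows (everything up to renaming of bound variables). *Terms and basis terms:* $t ::= x \mid \lambda x.t \mid (t)\,t \mid \alpha\cdot t \mid t+t$ and $b ::= x \mid \lambda x.t$, with $\alpha\in\mathcal S$ (there is no null term). *Reduction:* $\to$ is the relation on terms, the sum $+$ of terms being read modulo associativity and commutativity, generated by the rules - (E) $1\cdot t\to t$, $\ \alpha\cdot(\beta\cdot t)\to(\alpha\beta)\cdot t$, $\ \alpha\cdot(t+r)\to\alpha\cdot t+\alpha\cdot r$; - (F) $\alpha\cdot t+\beta\cdot t\to(\alpha+\beta)\cdot t$, $\ \alpha\cdot t+t\to(\alpha+1)\cdot t$, $\ t+t\to(1+1)\cdot t$; - (B) $(\lambda x.t)\,b\to t[b/x]$ for $b$ a basis term; - (A) $(t+r)\,u\to(t)\,u+(r)\,u$, $\ (t)\,(r+u)\to(t)\,r+(t)\,u$, $\ (\alpha\cdot t)\,r\to\alpha\cdot(t)\,r$, $\ (t)\,(\alpha\cdot r)\to\alpha\cdot(t)\,r$; and closed under the contexts $\alpha\cdot[\,]$,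 $u+[\,]$, $(u)\,[\,]$, $([\,])\,u$, $\lambda x.[\,]$. *Types:* general types $T ::= U\mid\alpha\cdot T\mid T+T\mid\mathbb X$ and unit types $U ::= \mathcal X\mid U\to T\mid\forall\mathcal X.U\mid\forall\mathbb X.U$, where unit variables $\mathcal X$ are to be replaced by unit types only and general variables $\mathbb X$ by arbitrary types. Type equivalence $\equiv$ is the least congruence with $1\cdot T\equiv T$, $\alpha\cdot(\beta\cdot T)\equiv(\alpha\beta)\cdot T$, $\alpha\cdot T+\alpha\cdot R\equiv\alpha\cdot(T+R)$, $\alpha\cdot T+\beta\cdot T\equiv(\alpha+\beta)\cdot T$, $T+R\equiv R+T$, $T+(R+S)\equiv(T+R)+S$. *Typing:* contexts $\Gamma$ are finite assignments of unit types to term variables. The judgement $\Gamma\vdash t:T$ is defined inductively by the following rules, in which $X$ is a type variable of either kind, $A$ is a unit type if $X$ is a unit variable and any type otherwise, all sums have at least one summand, and $\vec X$ may be empty: - ($ax$) $\Gamma,x:U\vdash x:U$; - ($\equiv$) from $\Gamma\vdash t:T$ and $R\equiv T$ infer $\Gamma\vdash t:R$; - ($\to_I$) from $\Gamma,x:U\vdash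 t:T$ infer $\Gamma\vdash\lambda x.t:U\to T$; - ($\to_E$) from $\Gamma\vdash t:\sum_{i=1}^n\alpha_i\cdot\forall\vec X.(U\to T_i)$ and $\Gamma\vdash r:\sum_{j=1}^m\beta_j\cdot U[\vec A_j/\vec X]$ infer $\Gamma\vdash(t)\,r:\sum_{i=1}^n\sum_{j=1}^m(\alpha_i\beta_j)\cdot T_i[\vec A_j/\vec X]$; - ($\forall_I$) from $\Gamma\vdash t:\sum_{i=1}^n\alpha_i\cdot U_i$ infer $\Gamma\vdash t:\sum_{i=1}^n\alpha_i\cdot\forall X.U_i$, if $X$ is not free in $\Gamma$; - ($\forall_E$) from $\Gamma\vdash t:\sum_{i=1}^n\alpha_i\cdot\forall X.U_i$ infer $\Gamma\vdash t:\sum_{i=1}^n\alpha_i\cdot U_i[A/X]$; - ($+_I$) from $\Gamma\vdash t:T$ and $\Gamma\vdash r:R$ infer $\Gamma\vdash t+r:T+R$; - ($1_E$) from $\Gamma\vdash 1\cdot t:T$ infer $\Gamma\vdash t:T$; - ($S$) from $\Gamma\vdash t:T_i$ for all $i\in\{1,\dots,n\}$ infer $\Gamma\vdash\bigl(\sum_{i=1}^n\alpha_i\bigr)\cdot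 t:\sum_{i=1}^n\alpha_i\cdot T_i$. Then for all terms $t,t'$, every context $\Gamma$ and every type $T$: if $t\to t'$ and $\Gamma\vdash t:T$, then $\Gamma\vdash t':T$. -/

import Mathlib

namespace LvecR

/-! Terms and types are represented with de Bruijn indices, so that they are automatically
identified up to renaming of bound variables. -/

/-! ### Terms -/

/-- Terms `t ::= x | λx.t | (t) t | α · t | t + t`, with scalars in `S`. There is no null term. -/
inductive Term (S : Type*) where
  | var (n : ℕ) : Term S
  | lam (t : Term S) : Term S
  | app (t r : Term S) : Term S
  | smul (a : S) (t : Term S) : Term S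
  | add (t r : Term S) : Term S

namespace Term

variable {S : Type*}

/-- The action on variables of a renaming under one more binder. -/
def upRen (ρ : ℕ → ℕ) : ℕ → ℕ
  | 0 => 0
  | n + 1 => ρ n + 1

/-- Renaming of the free variables of a term. -/
def rename : (ℕ → ℕ) → Term S → Term S
  | ρ, var n => var (ρ n)
  | ρ, lam t => lam (rename (upRen ρ) t)
  | ρ, app t r => app (rename ρ t) (rename ρ r)
  | ρ, smul a t => smul a (rename ρ t)
  | ρ, add t r => add (rename ρ t) (rename ρ r)

/-- A substitution under one more binder. -/
def upSubst (σ : ℕ → Term S) : ℕ → Term S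
  | 0 => var 0
  | n + 1 => rename Nat.succ (σ n)

/-- Simultaneous capture-avoiding substitution of terms for the free variables of a term. -/
def subst : (ℕ → Term S) → Term S → Term S
  | σ, var n => σ n
  | σ, lam t => lam (subst (upSubst σ) t)
  | σ, app t r => app (subst σ t) (subst σ r)
  | σ, smul a t => smul a (subst σ t)
  | σ, add t r => add (subst σ t) (subst σ r)

/-- The substitution that replaces the variable `0` by `b` and lowers the other variables. -/
def single (b : Term S) : ℕ → Term S
  | 0 => b
  | n + 1 => var n

/-- `t[b/x]`, where `x` is the variable bound by the innermost binder, i.e. the index `0`. -/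
def inst (t b : Term S) : Term S := subst (single b) t

/-- Basis terms `b ::= x | λx.t`. -/
inductive IsBasis : Term S → Prop
  | var (n : ℕ) : IsBasis (var n)
  | lam (t : Term S) : IsBasis (lam t)

end Term

/-! ### Reduction -/

/-- One-step reduction: the groups E, F, B, A and the contextual rules. -/
inductive Step {S : Type*} [CommRing S] : Term S → Term S → Prop
  -- Group E
  | one_smul (t : Term S) : Step (.smul 1 t) t
  | smul_smul (a b : S) (t : Term S) : Step (.smul a (.smul b t)) (.smul (a * b) t)
  | smul_add (a : S) (t r : Term S) :
      Step (.smul a (.add t r)) (.add (.smul a t) (.smul a r))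
  -- Group F
  | factor (a b : S) (t : Term S) : Step (.add (.smul a t) (.smul b t)) (.smul (a + b) t)
  | factor_one (a : S) (t : Term S) : Step (.add (.smul a t) t) (.smul (a + 1) t)
  | factor_one_one (t : Term S) : Step (.add t t) (.smul (1 + 1) t)
  -- Group B
  | beta (t b : Term S) : b.IsBasis → Step (.app (.lam t) b) (t.inst b)
  -- Group A
  | add_app (t r u : Term S) : Step (.app (.add t r) u) (.add (.app t u) (.app r u))
  | app_add (t r u : Term S) : Step (.app t (.add r u)) (.add (.app t r) (.app t u))
  | smul_app (a : S) (t r : Term S) : Step (.app (.smul a t) r) (.smul a (.app t r))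
  | app_smul (a : S) (t r : Term S) : Step (.app t (.smul a r)) (.smul a (.app t r))
  -- Contextual rules
  | ctx_smul {t r : Term S} (a : S) : Step t r → Step (.smul a t) (.smul a r)
  | ctx_add {t r : Term S} (u : Term S) : Step t r → Step (.add u t) (.add u r)
  | ctx_app_right {t r : Term S} (u : Term S) : Step t r → Step (.app u t) (.app u r)
  | ctx_app_left {t r : Term S} (u : Term S) : Step t r → Step (.app t u) (.app r u)
  | ctx_lam {t r : Term S} : Step t r → Step (.lam t) (.lam r)

/-- The least congruence on terms that makes `+` associative and commutative. -/
inductive ACEq {S : Type*} : Term S → Term S → Prop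
  | comm (t r : Term S) : ACEq (.add t r) (.add r t)
  | assoc (t r u : Term S) : ACEq (.add t (.add r u)) (.add (.add t r) u)
  | refl (t : Term S) : ACEq t t
  | symm {t r : Term S} : ACEq t r → ACEq r t
  | trans {t r u : Term S} : ACEq t r → ACEq r u → ACEq t u
  | lam {t t' : Term S} : ACEq t t' → ACEq (.lam t) (.lam t')
  | app {t t' r r' : Term S} : ACEq t t' → ACEq r r' → ACEq (.app t r) (.app t' r')
  | smul {t t' : Term S} (a : S) : ACEq t t' → ACEq (.smul a t) (.smul a t')
  | add {t t' r r' : Term S} : ACEq t t' → ACEq r r' → ACEq (.add t r) (.add t' r')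

/-- The reduction relation `t → t'` of the calculus, the sum of terms being read modulo
associativity and commutativity. It contains the relation `Step`, see `Step.red`. -/
def Red {S : Type*} [CommRing S] (t t' : Term S) : Prop :=
  ∃ s s' : Term S, ACEq t s ∧ Step s s' ∧ ACEq s' t'

theorem Step.red {S : Type*} [CommRing S] {t t' : Term S} (h : Step t t') : Red t t' :=
  ⟨t, t', .refl t, h, .refl t'⟩

/-! ### Types -/

/-- The two sorts of types, and of type variables. -/
inductive Sort2 where
  | unit
  | gen

/-- Types. `Ty S .gen` is the set of (general) types `T ::= U | α · T | T + T | 𝕏` and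
`Ty S .unit` the set of unit types `U ::= 𝒳 | U → T | ∀𝒳.U | ∀𝕏.U`.
The variables of the two sorts are numbered independently of each other: `var .unit n` is a unit
variable, `var .gen n` a general variable, and `all k` binds the variable `0` of sort `k`. -/
inductive Ty (S : Type*) : Sort2 → Type _ where
  | var (k : Sort2) (n : ℕ) : Ty S k
  | arrow (U : Ty S .unit) (T : Ty S .gen) : Ty S .unit
  | all (k : Sort2) (U : Ty S .unit) : Ty S .unit
  | ofUnit (U : Ty S .unit) : Ty S .gen
  | smul (a : S) (T : Ty S .gen) : Ty S .gen
  | add (T R : Ty S .gen) : Ty S .gen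

namespace Ty

variable {S : Type*}

/-- The renaming that makes room for a new variable `0` of sort `k`. -/
def shift : Sort2 → Sort2 → ℕ → ℕ
  | .unit, .unit, n => n + 1
  | .unit, .gen, n => n
  | .gen, .unit, n => n
  | .gen, .gen, n => n + 1

/-- A renaming under one more binder of sort `k`. -/
def upRen : Sort2 → (Sort2 → ℕ → ℕ) → Sort2 → ℕ → ℕ
  | .unit, _, .unit, 0 => 0
  | .unit, ρ, .unit, n + 1 => ρ .unit n + 1
  | .unit, ρ, .gen, n => ρ .gen n
  | .gen, ρ, .unit, n => ρ .unit n
  | .gen, _, .gen, 0 => 0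
  | .gen, ρ, .gen, n + 1 => ρ .gen n + 1

/-- Renaming of the free variables of a type. -/
def rename : (Sort2 → ℕ → ℕ) → {k : Sort2} → Ty S k → Ty S k
  | ρ, _, var k n => var k (ρ k n)
  | ρ, _, arrow U T => arrow (rename ρ U) (rename ρ T)
  | ρ, _, all k U => all k (rename (upRen k ρ) U)
  | ρ, _, ofUnit U => ofUnit (rename ρ U)
  | ρ, _, smul a T => smul a (rename ρ T)
  | ρ, _, add T R => add (rename ρ T) (rename ρ R)

/-- `cons k A σ` sends the variable `0` of sort `k` to `A`, the variable `n + 1` of sort `k` to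
the image of `n` under `σ`, and agrees with `σ` on the variables of the other sort. -/
def cons : (k : Sort2) → Ty S k → ((l : Sort2) → ℕ → Ty S l) → (l : Sort2) → ℕ → Ty S l
  | .unit, A, _, .unit, 0 => A
  | .unit, _, σ, .unit, n + 1 => σ .unit n
  | .unit, _, σ, .gen, n => σ .gen n
  | .gen, _, σ, .unit, n => σ .unit n
  | .gen, A, _, .gen, 0 => A
  | .gen, _, σ, .gen, n + 1 => σ .gen n

/-- A substitution under one more binder of sort `k`. -/
def upSubst (k : Sort2) (σ : (l : Sort2) → ℕ → Ty S l) : (l : Sort2) → ℕ → Ty S l :=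
  cons k (var k 0) fun l n => rename (shift k) (σ l n)

/-- Simultaneous capture-avoiding substitution: unit variables are replaced by unit types,
general variables by arbitrary types. -/
def subst : ((l : Sort2) → ℕ → Ty S l) → {k : Sort2} → Ty S k → Ty S k
  | σ, _, var k n => σ k n
  | σ, _, arrow U T => arrow (subst σ U) (subst σ T)
  | σ, _, all k U => all k (subst (upSubst k σ) U)
  | σ, _, ofUnit U => ofUnit (subst σ U)
  | σ, _, smul a T => smul a (subst σ T)
  | σ, _, add T R => add (subst σ T) (subst σ R)

/-- `∀X₁. … ∀Xₙ. U` for variables of the sorts `k₁, …, kₙ` listed in `ks`. -/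
def alls (ks : List Sort2) (U : Ty S .unit) : Ty S .unit := ks.foldr all U

/-- The substitution `[A₁/X₁, …, Aₙ/Xₙ]` where `X₁, …, Xₙ` are the variables bound (from the
outermost to the innermost) by the `n` innermost binders. -/
def substOf (As : List (Σ k : Sort2, Ty S k)) : (l : Sort2) → ℕ → Ty S l :=
  As.foldl (fun σ A => cons A.1 A.2 σ) var

/-- `T[A₁/X₁, …, Aₙ/Xₙ]`, see `substOf`. -/
def inst {k : Sort2} (T : Ty S k) (As : List (Σ k : Sort2, Ty S k)) : Ty S k :=
  subst (substOf As) T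

/-- The (non-empty) sum of the types `T 0, …, T n`. -/
def sum : (n : ℕ) → (Fin (n + 1) → Ty S .gen) → Ty S .gen
  | 0, T => T 0
  | n + 1, T => add (sum n fun i => T i.castSucc) (T (Fin.last (n + 1)))

end Ty

/-- Equivalence of types: the least congruence containing the six axioms. Two unit types are
equivalent when they are so as types. -/
inductive TyEquiv {S : Type*} [CommRing S] : Ty S .gen → Ty S .gen → Prop
  | one_smul (T : Ty S .gen) : TyEquiv (.smul 1 T) T
  | smul_smul (a b : S) (T : Ty S .gen) : TyEquiv (.smul a (.smul b T)) (.smul (a * b) T)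
  | smul_add (a : S) (T R : Ty S .gen) :
      TyEquiv (.add (.smul a T) (.smul a R)) (.smul a (.add T R))
  | add_smul (a b : S) (T : Ty S .gen) :
      TyEquiv (.add (.smul a T) (.smul b T)) (.smul (a + b) T)
  | add_comm (T R : Ty S .gen) : TyEquiv (.add T R) (.add R T)
  | add_assoc (T R Q : Ty S .gen) : TyEquiv (.add T (.add R Q)) (.add (.add T R) Q)
  | refl (T : Ty S .gen) : TyEquiv T T
  | symm {T R : Ty S .gen} : TyEquiv T R → TyEquiv R T
  | trans {T R Q : Ty S .gen} : TyEquiv T R → TyEquiv R Q → TyEquiv T Q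
  | smul {T T' : Ty S .gen} (a : S) : TyEquiv T T' → TyEquiv (.smul a T) (.smul a T')
  | add {T T' R R' : Ty S .gen} :
      TyEquiv T T' → TyEquiv R R' → TyEquiv (.add T R) (.add T' R')
  | arrow {U U' : Ty S .unit} {T T' : Ty S .gen} :
      TyEquiv (.ofUnit U) (.ofUnit U') → TyEquiv T T' →
        TyEquiv (.ofUnit (.arrow U T)) (.ofUnit (.arrow U' T'))
  | all {U U' : Ty S .unit} (k : Sort2) :
      TyEquiv (.ofUnit U) (.ofUnit U') → TyEquiv (.ofUnit (.all k U)) (.ofUnit (.all k U'))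

/-! ### Typing -/

/-- A context assigns unit types to finitely many term variables: the variable `n` has the
type in position `n` of the list. -/
abbrev Ctx (S : Type*) := List (Ty S .unit)

/-- `Γ` with its type variables renamed so that the variable `0` of sort `k` is not free in it. -/
def Ctx.shift {S : Type*} (k : Sort2) (Γ : Ctx S) : Ctx S := Γ.map (Ty.rename (Ty.shift k))

/-- `Typing Γ t T` is the typing judgement `Γ ⊢ t : T`. All sums of types are non-empty. -/
inductive Typing {S : Type*} [CommRing S] : Ctx S → Term S → Ty S .gen → Prop
  | ax {Γ : Ctx S} {n : ℕ} {U : Ty S .unit} :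
      Γ[n]? = some U → Typing Γ (.var n) (.ofUnit U)
  | equiv {Γ : Ctx S} {t : Term S} {T R : Ty S .gen} :
      Typing Γ t T → TyEquiv R T → Typing Γ t R
  | arrowI {Γ : Ctx S} {U : Ty S .unit} {t : Term S} {T : Ty S .gen} :
      Typing (U :: Γ) t T → Typing Γ (.lam t) (.ofUnit (.arrow U T))
  -- from `t : ∑ αᵢ · ∀X⃗.(U → Tᵢ)` and `r : ∑ βⱼ · U[A⃗ⱼ/X⃗]`
  -- infer `(t) r : ∑∑ (αᵢ × βⱼ) · Tᵢ[A⃗ⱼ/X⃗]`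
  | arrowE {Γ : Ctx S} {t r : Term S} {n m : ℕ} (α : Fin (n + 1) → S) (β : Fin (m + 1) → S)
      (ks : List Sort2) (U : Ty S .unit) (T : Fin (n + 1) → Ty S .gen)
      (A : Fin (m + 1) → List (Σ k : Sort2, Ty S k)) :
      (∀ j, (A j).map Sigma.fst = ks) →
      Typing Γ t (Ty.sum n fun i => .smul (α i) (.ofUnit (Ty.alls ks (.arrow U (T i))))) →
      Typing Γ r (Ty.sum m fun j => .smul (β j) (.ofUnit (U.inst (A j)))) →
      Typing Γ (.app t r)
        (Ty.sum n fun i => Ty.sum m fun j => .smul (α i * β j) ((T i).inst (A j)))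
  | allI {Γ : Ctx S} {t : Term S} {n : ℕ} (k : Sort2) (α : Fin (n + 1) → S)
      (U : Fin (n + 1) → Ty S .unit) :
      Typing (Γ.shift k) t (Ty.sum n fun i => .smul (α i) (.ofUnit (U i))) →
      Typing Γ t (Ty.sum n fun i => .smul (α i) (.ofUnit (.all k (U i))))
  | allE {Γ : Ctx S} {t : Term S} {n : ℕ} (k : Sort2) (α : Fin (n + 1) → S)
      (U : Fin (n + 1) → Ty S .unit) (A : Ty S k) :
      Typing Γ t (Ty.sum n fun i => .smul (α i) (.ofUnit (.all k (U i)))) →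
      Typing Γ t (Ty.sum n fun i => .smul (α i) (.ofUnit ((U i).inst [⟨k, A⟩])))
  | addI {Γ : Ctx S} {t r : Term S} {T R : Ty S .gen} :
      Typing Γ t T → Typing Γ r R → Typing Γ (.add t r) (.add T R)
  | oneE {Γ : Ctx S} {t : Term S} {T : Ty S .gen} :
      Typing Γ (.smul 1 t) T → Typing Γ t T
  | sumI {Γ : Ctx S} {t : Term S} {n : ℕ} (α : Fin (n + 1) → S)
      (T : Fin (n + 1) → Ty S .gen) :
      (∀ i, Typing Γ t (T i)) →
      Typing Γ (.smul (∑ i, α i) t) (Ty.sum n fun i => .smul (α i) (T i))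

end LvecR

namespace LvecR

universe u

/-! ### Substitution in types -/

namespace Ty

variable {S : Type*}

/-! Modulo `≡`, types form the free commutative semigroup with `S`-action, on the classes of unit
types and general variables (the atoms), that satisfies the module axioms without zero: `0 • T` is
not neutral but records that `T` occurs.

The rules (S) and (1_E) obstruct direct inversion, because a type of `α · t` may mix several types
of `t`. The remedy is the judgement `Graded Γ a t q`, read as "`a · t` has type `q`", which is
closed under linear combinations in `(a, q)` and under the quantifier rules at every grade. Then
`of_smul` moves a scalar from the term into the grade, which makes (1_E) admissible, and
`exists_of_add` splits the type of a sum. With `transfer`, which reduces a claim to the last head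
rule, most reductions become algebra of grades.

The price is the return to ordinary typing. `Graded.decomp` shows that a type of grade `a` is a
combination, with coefficients summing to `a`, of ordinary types of `t`. Its quantifier cases
compare this combination with a displayed combination of unit types. `exists_eval_of_add_eq` and
`exists_eval_of_smul_eq` decompose the displayed one along the other, and `Closed.transport`
iterates this. The same mechanism moves scalars out of applications.

For β, the coefficients in a type of a basis term sum to the grade and each atom is itself a type of
the term. For an abstraction each atom is a generalized arrow whose body is typed accordingly. Hence
the type of a β-redex is a combination of types of the contractum with coefficient sum `1`. -/

theorem rename_eq_subst (ρ : Sort2 → ℕ → ℕ) {k : Sort2} (T : Ty S k) :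
    rename ρ T = subst (fun l n => var l (ρ l n)) T := by
  induction T generalizing ρ with
  | var k n => rfl
  | arrow U T ihU ihT => simp only [rename, subst, ihU, ihT]
  | all k U ih =>
    simp only [rename, subst, ih]
    congr 2
    funext l n
    cases k <;> cases l <;> cases n <;> rfl
  | ofUnit U ih => simp only [rename, subst, ih]
  | smul a T ih => simp only [rename, subst, ih]
  | add T R ihT ihR => simp only [rename, subst, ihT, ihR]

theorem upSubst_var (k : Sort2) : upSubst k (var : (l : Sort2) → ℕ → Ty S l) = var := by
  funext l n
  cases k <;> cases l <;> cases n <;> rfl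

theorem subst_var {k : Sort2} (T : Ty S k) : subst var T = T := by
  induction T with
  | var k n => rfl
  | arrow U T ihU ihT => simp only [subst, ihU, ihT]
  | all k U ih => simp only [subst, upSubst_var, ih]
  | ofUnit U ih => simp only [subst, ih]
  | smul a T ih => simp only [subst, ih]
  | add T R ihT ihR => simp only [subst, ihT, ihR]

theorem subst_rename (ρ : Sort2 → ℕ → ℕ) (σ : (l : Sort2) → ℕ → Ty S l) {k : Sort2}
    (T : Ty S k) : subst σ (rename ρ T) = subst (fun l n => σ l (ρ l n)) T := by
  induction T generalizing ρ σ with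
  | var k n => rfl
  | arrow U T ihU ihT => simp only [rename, subst, ihU, ihT]
  | all k U ih =>
    simp only [rename, subst, ih]
    congr 2
    funext l n
    cases k <;> cases l <;> cases n <;> rfl
  | ofUnit U ih => simp only [rename, subst, ih]
  | smul a T ih => simp only [rename, subst, ih]
  | add T R ihT ihR => simp only [rename, subst, ihT, ihR]

theorem rename_rename (ρ τ : Sort2 → ℕ → ℕ) {k : Sort2} (T : Ty S k) :
    rename τ (rename ρ T) = rename (fun l n => τ l (ρ l n)) T := by
  rw [rename_eq_subst, subst_rename, rename_eq_subst]

theorem rename_upRen_shift (k : Sort2) (ρ : Sort2 → ℕ → ℕ) {l : Sort2} (T : Ty S l) :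
    rename (upRen k ρ) (rename (shift k) T) = rename (shift k) (rename ρ T) := by
  rw [rename_rename, rename_rename]
  congr 1
  funext l n
  cases k <;> cases l <;> rfl

theorem rename_subst (σ : (l : Sort2) → ℕ → Ty S l) (ρ : Sort2 → ℕ → ℕ) {k : Sort2}
    (T : Ty S k) : rename ρ (subst σ T) = subst (fun l n => rename ρ (σ l n)) T := by
  induction T generalizing ρ σ with
  | var k n => rfl
  | arrow U T ihU ihT => simp only [rename, subst, ihU, ihT]
  | all k U ih =>
    simp only [rename, subst, ih]
    congr 2
    funext l n
    cases k <;> cases l <;> cases n <;> first | rfl | exact rename_upRen_shift _ _ _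
  | ofUnit U ih => simp only [rename, subst, ih]
  | smul a T ih => simp only [rename, subst, ih]
  | add T R ihT ihR => simp only [rename, subst, ihT, ihR]

/-- Composition of substitutions: first `σ`, then `τ`. -/
def comp (σ τ : (l : Sort2) → ℕ → Ty S l) : (l : Sort2) → ℕ → Ty S l :=
  fun l n => subst τ (σ l n)

theorem subst_shift_cons (k : Sort2) (A : Ty S k) (σ : (l : Sort2) → ℕ → Ty S l) {l : Sort2}
    (T : Ty S l) : subst (cons k A σ) (rename (shift k) T) = subst σ T := by
  rw [subst_rename]
  congr 1
  funext l n
  cases k <;> cases l <;> rfl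

theorem subst_upSubst_shift (k : Sort2) (σ : (l : Sort2) → ℕ → Ty S l) {l : Sort2} (T : Ty S l) :
    subst (upSubst k σ) (rename (shift k) T) = rename (shift k) (subst σ T) := by
  rw [upSubst, subst_shift_cons, rename_subst]

theorem comp_upSubst (k : Sort2) (σ τ : (l : Sort2) → ℕ → Ty S l) :
    comp (upSubst k σ) (upSubst k τ) = upSubst k (comp σ τ) := by
  funext l n
  cases k <;> cases l <;> cases n <;> first | rfl | exact subst_upSubst_shift _ _ _

theorem subst_subst (σ τ : (l : Sort2) → ℕ → Ty S l) {k : Sort2} (T : Ty S k) :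
    subst τ (subst σ T) = subst (comp σ τ) T := by
  induction T generalizing σ τ with
  | var k n => rfl
  | arrow U T ihU ihT => simp only [subst, ihU, ihT]
  | all k U ih => simp only [subst, ih, comp_upSubst]
  | ofUnit U ih => simp only [subst, ih]
  | smul a T ih => simp only [subst, ih]
  | add T R ihT ihR => simp only [subst, ihT, ihR]

theorem comp_var (σ : (l : Sort2) → ℕ → Ty S l) : comp σ var = σ := by
  funext l n
  exact subst_var _

theorem comp_upSubst_cons (k : Sort2) (A : Ty S k) (σ τ : (l : Sort2) → ℕ → Ty S l) :
    comp (upSubst k τ) (cons k A σ) = cons k A (comp τ σ) := by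
  funext l n
  cases k <;> cases l <;> cases n <;> first | rfl | exact subst_shift_cons _ _ _ _

theorem comp_cons (k : Sort2) (A : Ty S k) (σ τ : (l : Sort2) → ℕ → Ty S l) :
    comp (cons k A σ) τ = cons k (subst τ A) (comp σ τ) := by
  funext l n
  cases k <;> cases l <;> cases n <;> rfl

/-- A substitution under the binders listed in `ks`, from the outermost to the innermost. -/
def upSubsts (ks : List Sort2) (σ : (l : Sort2) → ℕ → Ty S l) : (l : Sort2) → ℕ → Ty S l :=
  ks.foldl (fun σ k => upSubst k σ) σ

theorem subst_alls (ks : List Sort2) (σ : (l : Sort2) → ℕ → Ty S l) (U : Ty S .unit) :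
    subst σ (alls ks U) = alls ks (subst (upSubsts ks σ) U) := by
  induction ks generalizing σ with
  | nil => rfl
  | cons k ks ih => exact congrArg (all k) (ih (upSubst k σ))

/-- Simultaneous substitution of the types in `As` for the innermost variables, on top of `σ`. -/
def substOfFrom (σ : (l : Sort2) → ℕ → Ty S l) (As : List (Σ k : Sort2, Ty S k)) :
    (l : Sort2) → ℕ → Ty S l :=
  As.foldl (fun σ A => cons A.1 A.2 σ) σ

/-- The action of a substitution on a list of types. -/
def substList (τ : (l : Sort2) → ℕ → Ty S l) (As : List (Σ k : Sort2, Ty S k)) :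
    List (Σ k : Sort2, Ty S k) :=
  As.map fun A => ⟨A.1, subst τ A.2⟩

theorem map_fst_substList (τ : (l : Sort2) → ℕ → Ty S l) (As : List (Σ k : Sort2, Ty S k)) :
    (substList τ As).map Sigma.fst = As.map Sigma.fst := by
  simp [substList]

theorem comp_substOfFrom (σ τ : (l : Sort2) → ℕ → Ty S l) (As : List (Σ k : Sort2, Ty S k)) :
    comp (substOfFrom σ As) τ = substOfFrom (comp σ τ) (substList τ As) := by
  induction As generalizing σ with
  | nil => rfl
  | cons A As ih => exact (ih _).trans (by rw [comp_cons]; rfl)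

theorem comp_upSubsts_substOfFrom (σ τ : (l : Sort2) → ℕ → Ty S l)
    (As : List (Σ k : Sort2, Ty S k)) :
    comp (upSubsts (As.map Sigma.fst) τ) (substOfFrom σ As) = substOfFrom (comp τ σ) As := by
  induction As generalizing σ τ with
  | nil => rfl
  | cons A As ih => exact (ih _ _).trans (by rw [comp_upSubst_cons]; rfl)

/-- Both sides apply one substitution to `T`: the images of `As` under `τ` on the innermost
variables, and `τ` on the others. -/
theorem subst_inst (τ : (l : Sort2) → ℕ → Ty S l) (As : List (Σ k : Sort2, Ty S k)) {k : Sort2}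
    (T : Ty S k) :
    subst τ (T.inst As) = (subst (upSubsts (As.map Sigma.fst) τ) T).inst (substList τ As) := by
  have h₁ := comp_substOfFrom var τ As
  have h₂ := comp_upSubsts_substOfFrom var τ (substList τ As)
  rw [map_fst_substList, comp_var] at h₂
  unfold inst
  rw [subst_subst, subst_subst]
  exact congrArg (fun σ => subst σ T) (h₁.trans h₂.symm)

theorem subst_inst_singleton (τ : (l : Sort2) → ℕ → Ty S l) (k : Sort2) (A : Ty S k) {l : Sort2}
    (T : Ty S l) :
    subst τ (T.inst [⟨k, A⟩]) = (subst (upSubst k τ) T).inst [⟨k, subst τ A⟩] :=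
  subst_inst τ [⟨k, A⟩] T

end Ty

/-! ### Type substitutions in contexts -/

namespace Ctx

variable {S : Type*}

/-- The action of a type substitution on a context. -/
def subst (σ : (l : Sort2) → ℕ → Ty S l) (Γ : Ctx S) : Ctx S := Γ.map (Ty.subst σ)

/-- The iterated shift of a context, under the binders listed in `ks`. -/
def shifts (ks : List Sort2) (Γ : Ctx S) : Ctx S := ks.foldl (fun Γ k => Ctx.shift k Γ) Γ

theorem shift_eq_subst (k : Sort2) (Γ : Ctx S) :
    Γ.shift k = subst (fun l n => .var l (Ty.shift k l n)) Γ :=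
  List.map_congr_left fun U _ => Ty.rename_eq_subst _ U

theorem subst_shift (k : Sort2) (σ : (l : Sort2) → ℕ → Ty S l) (Γ : Ctx S) :
    subst (Ty.upSubst k σ) (Γ.shift k) = (subst σ Γ).shift k := by
  simp [subst, Ctx.shift, Ty.subst_upSubst_shift]

theorem subst_upSubsts_shifts (ks : List Sort2) (σ : (l : Sort2) → ℕ → Ty S l) (Γ : Ctx S) :
    subst (Ty.upSubsts ks σ) (shifts ks Γ) = shifts ks (subst σ Γ) := by
  induction ks generalizing σ Γ with
  | nil => rfl
  | cons k ks ih =>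
    refine (ih (Ty.upSubst k σ) (Γ.shift k)).trans ?_
    rw [subst_shift]
    rfl

theorem subst_cons_shift (k : Sort2) (A : Ty S k) (σ : (l : Sort2) → ℕ → Ty S l) (Γ : Ctx S) :
    subst (Ty.cons k A σ) (Γ.shift k) = subst σ Γ := by
  simp [subst, Ctx.shift, Ty.subst_shift_cons]

theorem subst_var (Γ : Ctx S) : subst Ty.var Γ = Γ := by
  refine (List.map_congr_left fun U _ => Ty.subst_var U).trans ?_
  simp

theorem subst_substOfFrom_shifts (σ : (l : Sort2) → ℕ → Ty S l)
    (As : List (Σ k : Sort2, Ty S k)) (Γ : Ctx S) :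
    subst (Ty.substOfFrom σ As) (shifts (As.map Sigma.fst) Γ) = subst σ Γ := by
  induction As generalizing σ Γ with
  | nil => rfl
  | cons A As ih => exact (ih _ _).trans (subst_cons_shift _ _ _ _)

/-- Instantiating bound variables undoes the shift made when they were generalized, so a derivation
under quantifiers returns to the original context. -/
theorem subst_substOf_shifts (As : List (Σ k : Sort2, Ty S k)) (Γ : Ctx S) :
    subst (Ty.substOf As) (shifts (As.map Sigma.fst) Γ) = Γ :=
  (subst_substOfFrom_shifts Ty.var As Γ).trans (subst_var Γ)

end Ctx

theorem TyEquiv.subst {S : Type*} [CommRing S] {T R : Ty S .gen} (h : TyEquiv T R)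
    (σ : (l : Sort2) → ℕ → Ty S l) : TyEquiv (T.subst σ) (R.subst σ) := by
  induction h generalizing σ with
  | one_smul T => exact .one_smul _
  | smul_smul a b T => exact .smul_smul _ _ _
  | smul_add a T R => exact .smul_add _ _ _
  | add_smul a b T => exact .add_smul _ _ _
  | add_comm T R => exact .add_comm _ _
  | add_assoc T R Q => exact .add_assoc _ _ _
  | refl T => exact .refl _
  | symm _ ih => exact .symm (ih σ)
  | trans _ _ ih₁ ih₂ => exact .trans (ih₁ σ) (ih₂ σ)
  | smul a _ ih => exact .smul a (ih σ)
  | add _ _ ih₁ ih₂ => exact .add (ih₁ σ) (ih₂ σ)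
  | arrow _ _ ih₁ ih₂ => exact .arrow (ih₁ σ) (ih₂ σ)
  | all k _ ih => exact .all k (ih _)

/-! ### Modules without a neutral element -/

/-- A commutative semigroup with an action of `S` that satisfies the axioms of a module, except
that there is no neutral element: `0 • x` need not be neutral. -/
class WeakModule (S M : Type*) [CommRing S] [AddCommSemigroup M] extends MulAction S M where
  smul_add (a : S) (x y : M) : a • (x + y) = a • x + a • y
  add_smul (a b : S) (x : M) : (a + b) • x = a • x + b • x

namespace WeakModule

variable {S M : Type*} [CommRing S] [AddCommSemigroup M] [WeakModule S M]

theorem add_smul_self (a : S) (x : M) : x + a • x = (1 + a) • x := by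
  rw [add_smul, one_smul]

/-- This replaces the neutral element: a multiple by `0` can be dropped only next to something that
absorbs it. -/
theorem add_zero_smul (x : M) : x + (0 : S) • x = x := by
  rw [add_smul_self, add_zero, one_smul]

/-- The sum of a non-empty family. -/
def nsum : (n : ℕ) → (Fin (n + 1) → M) → M
  | 0, x => x 0
  | n + 1, x => nsum n (fun i => x i.castSucc) + x (Fin.last (n + 1))

theorem smul_nsum (a : S) (n : ℕ) (x : Fin (n + 1) → M) :
    a • nsum n x = nsum n fun i => a • x i := by
  induction n with
  | zero => rfl
  | succ n ih => simp only [nsum, smul_add, ih]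

end WeakModule

open WeakModule

instance {S : Type*} [CommRing S] : WeakModule S S where
  smul_add := mul_add
  add_smul := add_mul

theorem nsum_eq_sum {S : Type*} [CommRing S] (n : ℕ) (x : Fin (n + 1) → S) :
    nsum n x = ∑ i, x i := by
  induction n with
  | zero => simp [nsum]
  | succ n ih => rw [nsum, ih, Fin.sum_univ_castSucc (n := n + 1)]

/-- Propositions, with conjunction as addition and the trivial scalar action. -/
structure Conj where
  holds : Prop

namespace Conj

instance : AddCommSemigroup Conj where
  add p q := ⟨p.holds ∧ q.holds⟩
  add_assoc _ _ _ := congrArg Conj.mk (propext and_assoc)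
  add_comm _ _ := congrArg Conj.mk (propext and_comm)

/-- Idempotence of conjunction gives distributivity over scalar addition. Linear maps into `Conj`
therefore see which atoms occur, even with coefficient `0`. -/
instance {S : Type*} [CommRing S] : WeakModule S Conj where
  smul _ p := p
  one_smul _ := rfl
  mul_smul _ _ _ := rfl
  smul_add _ _ _ := rfl
  add_smul _ _ p := congrArg Conj.mk (propext (and_self_iff (a := p.holds)).symm)

end Conj

/-! ### Types modulo equivalence -/

section Quotient

variable {S : Type*} [CommRing S]

instance tySetoid (S : Type*) [CommRing S] : Setoid (Ty S .gen) where
  r := TyEquiv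
  iseqv := ⟨.refl, .symm, .trans⟩

/-- Types modulo equivalence. -/
def QTy (S : Type*) [CommRing S] : Type _ := Quotient (tySetoid S)

/-- The class of a type. -/
def cls (T : Ty S .gen) : QTy S := Quotient.mk _ T

/-- The class of a unit type. -/
def ucls (U : Ty S .unit) : QTy S := cls (.ofUnit U)

theorem cls_eq_iff {T R : Ty S .gen} : cls T = cls R ↔ TyEquiv T R :=
  ⟨fun h => Quotient.exact h, fun h => Quotient.sound h⟩

theorem ucls_eq_iff {U V : Ty S .unit} : ucls U = ucls V ↔ TyEquiv (.ofUnit U) (.ofUnit V) :=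
  cls_eq_iff

theorem TyEquiv.cls_eq {T R : Ty S .gen} (h : TyEquiv T R) : cls T = cls R := cls_eq_iff.2 h

theorem exists_cls (q : QTy S) : ∃ T : Ty S .gen, cls T = q := Quotient.exists_rep q

instance : AddCommSemigroup (QTy S) where
  add := Quotient.map₂ Ty.add fun _ _ h₁ _ _ h₂ => TyEquiv.add h₁ h₂
  add_assoc := by
    rintro ⟨T⟩ ⟨R⟩ ⟨Q⟩
    exact (TyEquiv.add_assoc T R Q).symm.cls_eq
  add_comm := by
    rintro ⟨T⟩ ⟨R⟩
    exact (TyEquiv.add_comm T R).cls_eq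

instance : WeakModule S (QTy S) where
  smul a := Quotient.map (Ty.smul a) fun _ _ h => TyEquiv.smul a h
  one_smul := by
    rintro ⟨T⟩
    exact (TyEquiv.one_smul T).cls_eq
  mul_smul := by
    rintro a b ⟨T⟩
    exact (TyEquiv.smul_smul a b T).symm.cls_eq
  smul_add := by
    rintro a ⟨T⟩ ⟨R⟩
    exact (TyEquiv.smul_add a T R).symm.cls_eq
  add_smul := by
    rintro a b ⟨T⟩
    exact (TyEquiv.add_smul a b T).symm.cls_eq

theorem cls_add (T R : Ty S .gen) : cls (.add T R) = cls T + cls R := rfl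

theorem cls_smul (a : S) (T : Ty S .gen) : cls (.smul a T) = a • cls T := rfl

theorem cls_sum (n : ℕ) (T : Fin (n + 1) → Ty S .gen) :
    cls (Ty.sum n T) = nsum n fun i => cls (T i) := by
  induction n with
  | zero => rfl
  | succ n ih => simp only [Ty.sum, nsum, cls_add, ih]

@[elab_as_elim]
theorem QTy.induction {P : QTy S → Prop} (var : ∀ n, P (cls (.var .gen n)))
    (ofUnit : ∀ U, P (ucls U)) (smul : ∀ (a : S) q, P q → P (a • q))
    (add : ∀ q r, P q → P r → P (q + r)) (q : QTy S) : P q := by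
  suffices h : ∀ {k} (T : Ty S k) (hk : k = .gen), P (cls (hk ▸ T)) by
    obtain ⟨T, rfl⟩ := exists_cls q
    exact h T rfl
  intro k T
  induction T with
  | var k n => rintro rfl; exact var n
  | arrow U T _ _ => intro hk; cases hk
  | all k U _ => intro hk; cases hk
  | ofUnit U _ => intro _; exact ofUnit U
  | smul a T ih => intro _; exact smul a _ (ih rfl)
  | add T R ihT ihR => intro _; exact add _ _ (ihT rfl) (ihR rfl)

variable {M : Type*} [AddCommSemigroup M] [WeakModule S M]

/-- The linear map on types with the given values on general variables and unit types. -/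
def Ty.lift (G : ℕ → M) (F : Ty S .unit → M) : {k : Sort2} → Ty S k → M
  | _, .var .unit n => F (.var .unit n)
  | _, .var .gen n => G n
  | _, .arrow U T => F (.arrow U T)
  | _, .all k U => F (.all k U)
  | _, .ofUnit U => F U
  | _, .smul a T => a • lift G F T
  | _, .add T R => lift G F T + lift G F R

/-- All axioms of `≡` are module laws; the only other rules act inside an arrow or a quantifier,
which is what the two hypotheses cover. -/
theorem TyEquiv.lift_eq {G : ℕ → M} {F : Ty S .unit → M}
    (harrow : ∀ U U' T T', ucls U = ucls U' → cls T = cls T' → F (.arrow U T) = F (.arrow U' T'))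
    (hall : ∀ k U U', ucls U = ucls U' → F (.all k U) = F (.all k U'))
    {T R : Ty S .gen} (h : TyEquiv T R) : T.lift G F = R.lift G F := by
  induction h with
  | one_smul T => exact _root_.one_smul _ _
  | smul_smul a b T => exact (mul_smul _ _ _).symm
  | smul_add a T R => exact (WeakModule.smul_add _ _ _).symm
  | add_smul a b T => exact (WeakModule.add_smul _ _ _).symm
  | add_comm T R => exact _root_.add_comm _ _
  | add_assoc T R Q => exact (_root_.add_assoc _ _ _).symm
  | refl T => rfl
  | symm _ ih => exact ih.symm
  | trans _ _ ih₁ ih₂ => exact ih₁.trans ih₂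
  | smul a _ ih => exact congrArg (a • ·) ih
  | add _ _ ih₁ ih₂ => exact congrArg₂ (· + ·) ih₁ ih₂
  | arrow h₁ h₂ _ _ => exact harrow _ _ _ _ h₁.cls_eq h₂.cls_eq
  | all k h _ => exact hall _ _ _ h.cls_eq

/-- The linear map on classes of types with the given values on the classes of general variables
and unit types. -/
def QTy.lift (F : QTy S → M) : QTy S → M :=
  Quotient.lift (Ty.lift (fun n => F (cls (.var .gen n))) fun U => F (ucls U)) fun _ _ h =>
    TyEquiv.lift_eq
      (fun _ _ _ _ h₁ h₂ => congrArg F (TyEquiv.arrow (ucls_eq_iff.1 h₁) (cls_eq_iff.1 h₂)).cls_eq)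
      (fun k _ _ h => congrArg F (TyEquiv.all k (ucls_eq_iff.1 h)).cls_eq) h

theorem QTy.lift_add (F : QTy S → M) (q r : QTy S) :
    QTy.lift F (q + r) = QTy.lift F q + QTy.lift F r := by
  obtain ⟨⟨T⟩, ⟨R⟩⟩ := q, r
  rfl

theorem QTy.lift_smul (F : QTy S → M) (a : S) (q : QTy S) :
    QTy.lift F (a • q) = a • QTy.lift F q := by
  obtain ⟨T⟩ := q
  rfl

/-- All general variables and unit types that occur at the top level of a type satisfy `P`. -/
def QTy.AllAtoms (P : QTy S → Prop) (q : QTy S) : Prop := (QTy.lift (fun r => Conj.mk (P r)) q).holds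

namespace QTy

theorem allAtoms_add {P : QTy S → Prop} {q r : QTy S} :
    AllAtoms P (q + r) ↔ AllAtoms P q ∧ AllAtoms P r := by
  unfold AllAtoms
  rw [lift_add]
  rfl

theorem allAtoms_smul {P : QTy S → Prop} {a : S} {q : QTy S} :
    AllAtoms P (a • q) ↔ AllAtoms P q := by
  unfold AllAtoms
  rw [lift_smul]
  rfl

theorem AllAtoms.mono {P P' : QTy S → Prop} (h : ∀ r, P r → P' r) {q : QTy S}
    (hq : AllAtoms P q) : AllAtoms P' q := by
  induction q using QTy.induction with
  | var n => exact h _ hq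
  | ofUnit U => exact h _ hq
  | smul a q ih => exact allAtoms_smul.2 (ih (allAtoms_smul.1 hq))
  | add q r ihq ihr =>
    obtain ⟨h₁, h₂⟩ := allAtoms_add.1 hq
    exact allAtoms_add.2 ⟨ihq h₁, ihr h₂⟩

/-- The sum of the coefficients of a type. -/
def total (q : QTy S) : S := QTy.lift (fun _ => 1) q

theorem total_add (q r : QTy S) : total (q + r) = total q + total r := lift_add _ _ _

theorem total_smul (a : S) (q : QTy S) : total (a • q) = a * total q := lift_smul _ _ _

/-- Substitution in a class of types. -/
def subst (σ : (l : Sort2) → ℕ → Ty S l) : QTy S → QTy S :=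
  Quotient.map (Ty.subst σ) fun _ _ h => h.subst σ

theorem subst_add (σ : (l : Sort2) → ℕ → Ty S l) (q r : QTy S) :
    subst σ (q + r) = subst σ q + subst σ r := by
  obtain ⟨⟨T⟩, ⟨R⟩⟩ := q, r
  rfl

theorem subst_smul (σ : (l : Sort2) → ℕ → Ty S l) (a : S) (q : QTy S) :
    subst σ (a • q) = a • subst σ q := by
  obtain ⟨T⟩ := q
  rfl

theorem subst_cls (σ : (l : Sort2) → ℕ → Ty S l) (T : Ty S .gen) :
    subst σ (cls T) = cls (T.subst σ) := rfl

theorem subst_ucls (σ : (l : Sort2) → ℕ → Ty S l) (U : Ty S .unit) :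
    subst σ (ucls U) = ucls (U.subst σ) := rfl

/-- If a class `p` of general variables or unit types occurs in `q`, then adding `0 • p` to `q`
has no effect. -/
theorem add_zero_smul_of_not_allAtoms {p q : QTy S} (h : ¬ AllAtoms (· ≠ p) q) :
    q + (0 : S) • p = q := by
  induction q using QTy.induction with
  | var n =>
    have h' : ¬ cls (.var .gen n) ≠ p := h
    rw [← not_not.1 h', add_zero_smul]
  | ofUnit U =>
    have h' : ¬ ucls U ≠ p := h
    rw [← not_not.1 h', add_zero_smul]
  | smul a q ih =>
    have := ih (mt allAtoms_smul.2 h)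
    conv_rhs => rw [← this]
    rw [WeakModule.smul_add, ← mul_smul, mul_zero]
  | add q r ihq ihr =>
    rw [allAtoms_add, not_and_or] at h
    rcases h with h | h
    · rw [add_right_comm, ihq h]
    · rw [add_assoc, ihr h]

end QTy

/-! ### Inversion of equivalences between unit types -/

/-- The predicate "equivalent to `∀ U`, with a quantifier of sort `k` in front" respects
equivalence, so it extends to a linear map into `Conj`, an invariant of classes. The two lemmas that
follow use the same device. -/
theorem ucls_all_inj {k k' : Sort2} {U U' : Ty S .unit} (h : ucls (.all k U) = ucls (.all k' U')) :
    k = k' ∧ ucls U = ucls U' := by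
  have := (ucls_eq_iff.1 h).lift_eq (M := Conj) (G := fun _ => ⟨False⟩)
    (F := fun V => ⟨∃ W, V = .all k W ∧ ucls U = ucls W⟩) (by simp)
    (fun l V V' hV => by simp [hV])
  obtain ⟨W, hW, hU⟩ := (congrArg Conj.holds this).mp ⟨U, rfl, rfl⟩
  cases hW
  exact ⟨rfl, hU⟩

theorem ucls_arrow_inj {U U' : Ty S .unit} {T T' : Ty S .gen}
    (h : ucls (.arrow U T) = ucls (.arrow U' T')) : ucls U = ucls U' ∧ cls T = cls T' := by
  have := (ucls_eq_iff.1 h).lift_eq (M := Conj) (G := fun _ => ⟨False⟩)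
    (F := fun V => ⟨∃ W R, V = .arrow W R ∧ ucls U = ucls W ∧ cls T = cls R⟩)
    (fun V V' R R' hV hR => by simp [hV, hR]) (by simp)
  obtain ⟨W, R, hW, hU⟩ := (congrArg Conj.holds this).mp ⟨U, T, rfl, rfl, rfl⟩
  cases hW
  exact hU

theorem ucls_all_ne_arrow {k : Sort2} {U V : Ty S .unit} {T : Ty S .gen} :
    ucls (.all k U) ≠ ucls (.arrow V T) := by
  intro h
  have := (ucls_eq_iff.1 h).lift_eq (M := Conj) (G := fun _ => ⟨False⟩)
    (F := fun W => ⟨∃ k V, W = .all k V⟩) (by simp) (by simp)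
  obtain ⟨k, V, hV⟩ := (congrArg Conj.holds this).mp ⟨k, U, rfl⟩
  cases hV

theorem ucls_all_congr (k : Sort2) {U U' : Ty S .unit} (h : ucls U = ucls U') :
    ucls (.all k U) = ucls (.all k U') :=
  (TyEquiv.all k (ucls_eq_iff.1 h)).cls_eq

theorem ucls_subst_congr (σ : (l : Sort2) → ℕ → Ty S l) {U U' : Ty S .unit}
    (h : ucls U = ucls U') : ucls (U.subst σ) = ucls (U'.subst σ) :=
  congrArg (QTy.subst σ) h

theorem ucls_alls_arrow_inj {ks ks' : List Sort2} {U U' : Ty S .unit} {T T' : Ty S .gen}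
    (h : ucls (Ty.alls ks (.arrow U T)) = ucls (Ty.alls ks' (.arrow U' T'))) :
    ks = ks' ∧ ucls U = ucls U' ∧ cls T = cls T' := by
  induction ks generalizing ks' with
  | nil =>
    cases ks' with
    | nil => exact ⟨rfl, ucls_arrow_inj h⟩
    | cons k' ks' => exact absurd h.symm ucls_all_ne_arrow
  | cons k ks ih =>
    cases ks' with
    | nil => exact absurd h ucls_all_ne_arrow
    | cons k' ks' =>
      obtain ⟨rfl, h'⟩ := ucls_all_inj h
      obtain ⟨rfl, h''⟩ := ih h'
      exact ⟨rfl, h''⟩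

end Quotient

/-! ### Formal linear combinations -/

/-- Formal non-empty linear combinations of elements of `ι`. -/
inductive Comb (S ι : Type*) where
  | pure (i : ι) : Comb S ι
  | smul (a : S) (c : Comb S ι) : Comb S ι
  | add (c d : Comb S ι) : Comb S ι

namespace Comb

variable {S ι κ : Type*}

/-- The elements that occur in a combination. -/
def Mem (i : ι) : Comb S ι → Prop
  | pure j => i = j
  | smul _ c => Mem i c
  | add c d => Mem i c ∨ Mem i d

/-- The combination `x 0 + ⋯ + x n`. -/
def nsum : (n : ℕ) → (Fin (n + 1) → Comb S ι) → Comb S ι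
  | 0, x => x 0
  | n + 1, x => add (nsum n fun i => x i.castSucc) (x (Fin.last (n + 1)))

theorem nonempty (c : Comb S ι) : Nonempty ι := by
  induction c with
  | pure i => exact ⟨i⟩
  | smul a c ih => exact ih
  | add c d ihc _ => exact ihc

variable [CommRing S] {M : Type*} [AddCommSemigroup M] [WeakModule S M]

/-- The value of a combination in a module. -/
def eval (g : ι → M) : Comb S ι → M
  | pure i => g i
  | smul a c => a • eval g c
  | add c d => eval g c + eval g d

theorem eval_nsum (g : ι → M) (n : ℕ) (x : Fin (n + 1) → Comb S ι) :
    (nsum n x).eval g = WeakModule.nsum n fun i => (x i).eval g := by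
  induction n with
  | zero => rfl
  | succ n ih => simp only [nsum, eval, WeakModule.nsum, ih]

theorem eval_congr {c : Comb S ι} {g g' : ι → M} (h : ∀ i, c.Mem i → g i = g' i) :
    c.eval g = c.eval g' := by
  induction c with
  | pure i => exact h i rfl
  | smul a c ih => exact congrArg (a • ·) (ih h)
  | add c d ihc ihd =>
    exact congrArg₂ (· + ·) (ihc fun i hi => h i (.inl hi)) (ihd fun i hi => h i (.inr hi))

theorem eval_add (c : Comb S ι) (g g' : ι → M) :
    (c.eval fun i => g i + g' i) = c.eval g + c.eval g' := by
  induction c with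
  | pure i => rfl
  | smul a c ih => simp only [eval, ih, WeakModule.smul_add]
  | add c d ihc ihd => simp only [eval, ihc, ihd, add_add_add_comm]

theorem eval_smul (c : Comb S ι) (a : S) (g : ι → M) :
    (c.eval fun i => a • g i) = a • c.eval g := by
  induction c with
  | pure i => rfl
  | smul b c ih => simp only [eval, ih, smul_comm a b]
  | add c d ihc ihd => simp only [eval, ihc, ihd, WeakModule.smul_add]

theorem eval_comm (c : Comb S ι) (d : Comb S κ) (g : ι → κ → M) :
    (c.eval fun i => d.eval fun j => g i j) = d.eval fun j => c.eval fun i => g i j := by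
  induction c with
  | pure i => rfl
  | smul a c ih => simp only [eval, ih, eval_smul]
  | add c c' ih ih' => simp only [eval, ih, ih', eval_add]

/-- The sum of the coefficients of a combination. -/
def total (c : Comb S ι) : S := c.eval fun _ => 1

theorem lift_eval (F : QTy S → M) (c : Comb S ι) (f : ι → Ty S .unit) :
    QTy.lift F (c.eval fun i => ucls (f i)) = c.eval fun i => F (ucls (f i)) := by
  induction c with
  | pure i => rfl
  | smul a c ih => simp only [eval, QTy.lift_smul, ih]
  | add c d ihc ihd => simp only [eval, QTy.lift_add, ihc, ihd]

theorem subst_eval (σ : (l : Sort2) → ℕ → Ty S l) (c : Comb S ι) (g : ι → QTy S) :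
    (c.eval g).subst σ = c.eval fun i => (g i).subst σ := by
  induction c with
  | pure i => rfl
  | smul a c ih => simp only [eval, QTy.subst_smul, ih]
  | add c d ihc ihd => simp only [eval, QTy.subst_add, ihc, ihd]

theorem total_eval (c : Comb S ι) (f : ι → Ty S .unit) :
    (c.eval fun i => ucls (f i)).total = c.total :=
  lift_eval _ _ _

theorem allAtoms_eval {P : QTy S → Prop} (c : Comb S ι) (g : ι → QTy S) :
    QTy.AllAtoms P (c.eval g) ↔ ∀ i, c.Mem i → QTy.AllAtoms P (g i) := by
  induction c with
  | pure i => simp [eval, Mem]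
  | smul a c ih => simpa [eval, Mem, QTy.allAtoms_smul] using ih
  | add c d ihc ihd => simp [eval, Mem, QTy.allAtoms_add, ihc, ihd, or_imp, forall_and]

/-- If two combinations of unit types agree, then so do their images under a map that is
compatible with equivalence. -/
theorem eval_eq_of_eval_eq {c d : Comb S ι} {f : ι → Ty S .unit} {g : ι → M}
    (h : (c.eval fun i => ucls (f i)) = d.eval fun i => ucls (f i))
    (hg : ∀ i j, ucls (f i) = ucls (f j) → g i = g j) : c.eval g = d.eval g := by
  classical
  have i₀ := c.nonempty.some
  -- `F` reads off `g` at a chosen index of the class; `hg` makes the choice harmless, and `i₀` only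
  -- fills in classes that are not of the form `ucls (f i)`.
  let F : QTy S → M := fun q => if hq : ∃ i, ucls (f i) = q then g hq.choose else g i₀
  have hF : (fun i => F (ucls (f i))) = g := by
    funext i
    have hi : ∃ j, ucls (f j) = ucls (f i) := ⟨i, rfl⟩
    simp only [F, dif_pos hi]
    exact hg _ _ hi.choose_spec
  have := congrArg (QTy.lift F) h
  rwa [lift_eval, lift_eval, hF] at this

/-- The zero multiple of each index of `d` is absorbed at an occurrence of that index in `c`. -/
theorem add_zero_smul_eval {c d : Comb S ι} (h : ∀ i, d.Mem i → c.Mem i) (g : ι → M) :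
    c.eval g + (0 : S) • d.eval g = c.eval g := by
  have single : ∀ (c : Comb S ι) i, c.Mem i → c.eval g + (0 : S) • g i = c.eval g := by
    intro c i hi
    induction c with
    | pure j => rw [show i = j from hi]; exact add_zero_smul _
    | smul a c ih =>
      have := congrArg (a • ·) (ih hi)
      simpa only [eval, WeakModule.smul_add, ← mul_smul, mul_zero] using this
    | add c d ihc ihd =>
      simp only [eval]
      rcases hi with hi | hi
      · rw [add_right_comm, ihc hi]
      · rw [add_assoc, ihd hi]
  induction d with
  | pure i => exact single c i (h i rfl)
  | smul a d ih => simpa only [eval, ← mul_smul, zero_mul] using ih h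
  | add d e ihd ihe =>
    rw [eval, WeakModule.smul_add, ← add_assoc, ihd fun i hi => h i (.inl hi),
      ihe fun i hi => h i (.inr hi)]

/-- Replacing each atom of `q` by an index with that value rebuilds `q`; `P` restricts the indices
used. -/
theorem exists_eval_of_allAtoms {P : ι → Prop} {g : ι → QTy S} {q : QTy S}
    (h : QTy.AllAtoms (fun r => ∃ i, P i ∧ g i = r) q) :
    ∃ c : Comb S ι, (∀ i, c.Mem i → P i) ∧ c.eval g = q := by
  induction q using QTy.induction with
  | var n =>
    obtain ⟨i, hi, h⟩ := h
    exact ⟨pure i, fun j hj => by rwa [show j = i from hj], h⟩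
  | ofUnit U =>
    obtain ⟨i, hi, h⟩ := h
    exact ⟨pure i, fun j hj => by rwa [show j = i from hj], h⟩
  | smul a q ih =>
    obtain ⟨c, hc, rfl⟩ := ih (QTy.allAtoms_smul.1 h)
    exact ⟨smul a c, hc, rfl⟩
  | add q r ihq ihr =>
    obtain ⟨hq, hr⟩ := QTy.allAtoms_add.1 h
    obtain ⟨c, hc, rfl⟩ := ihq hq
    obtain ⟨d, hd, rfl⟩ := ihr hr
    exact ⟨add c d, fun i hi => hi.elim (hc i) (hd i), rfl⟩

/-- The indices of a combination of unit types can be replaced by representatives of the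
classes of the indices that give equivalent types. -/
theorem exists_representatives (d : Comb S ι) (f : ι → Ty S .unit) :
    ∃ s : ι → ι, (∀ i, d.Mem i → d.Mem (s i) ∧ ucls (f (s i)) = ucls (f i)) ∧
      ∀ i j, ucls (f i) = ucls (f j) → s i = s j := by
  classical
  have i₀ := d.nonempty.some
  let s : QTy S → ι := fun q =>
    if hq : ∃ i, d.Mem i ∧ ucls (f i) = q then hq.choose else i₀
  refine ⟨fun i => s (ucls (f i)), fun i hi => ?_, fun i j h => congrArg s h⟩
  have h : ∃ j, d.Mem j ∧ ucls (f j) = ucls (f i) := ⟨i, hi, rfl⟩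
  simp only [s, dif_pos h]
  exact h.choose_spec

/-- Any part of a combination of unit types is a combination of representatives. -/
theorem exists_eval_representatives {d : Comb S ι} {f : ι → Ty S .unit} {s : ι → ι}
    (hs : ∀ i, d.Mem i → d.Mem (s i) ∧ ucls (f (s i)) = ucls (f i))
    (hs' : ∀ i j, ucls (f i) = ucls (f j) → s i = s j) {q : QTy S}
    (h : QTy.AllAtoms (fun r => ∃ i, d.Mem i ∧ ucls (f i) = r) q) :
    ∃ c : Comb S ι, (∀ i, c.Mem i → d.Mem i ∧ s i = i) ∧ (c.eval fun i => ucls (f i)) = q := by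
  refine exists_eval_of_allAtoms (P := fun i => d.Mem i ∧ s i = i) (QTy.AllAtoms.mono ?_ h)
  rintro r ⟨i, hi, rfl⟩
  exact ⟨s i, ⟨(hs i hi).1, hs' _ _ (hs i hi).2⟩, (hs i hi).2⟩

theorem allAtoms_mem_eval (d : Comb S ι) (f : ι → Ty S .unit) :
    QTy.AllAtoms (fun r => ∃ i, d.Mem i ∧ ucls (f i) = r) (d.eval fun i => ucls (f i)) :=
  (allAtoms_eval _ _).2 fun i hi => ⟨i, hi, rfl⟩

/-- Equivalence never erases an atom, so `ucls (f i)` occurs in `q` or in `r`, and that summand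
absorbs its zero multiple. -/
theorem add_zero_smul_of_mem {d : Comb S ι} {f : ι → Ty S .unit} {q r : QTy S}
    (h : q + r = d.eval fun i => ucls (f i)) {i : ι} (hi : d.Mem i) :
    q + (0 : S) • ucls (f i) = q ∨ r + (0 : S) • ucls (f i) = r := by
  have : ¬ QTy.AllAtoms (· ≠ ucls (f i)) (q + r) := by
    rw [h, allAtoms_eval]
    exact fun h' => h' i hi rfl
  rw [QTy.allAtoms_add, not_and_or] at this
  exact this.imp QTy.add_zero_smul_of_not_allAtoms QTy.add_zero_smul_of_not_allAtoms

theorem add_add_neg_smul (x y : M) : x + (y + (-1 : S) • x) = y + (0 : S) • x := by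
  rw [add_left_comm, add_smul_self, add_neg_cancel]

/-- A combination of unit types that equals a sum `q + r` is the sum of two combinations, one for
each summand. -/
theorem exists_eval_of_add_eq {q r : QTy S} {d : Comb S ι} {f : ι → Ty S .unit}
    (h : q + r = d.eval fun i => ucls (f i)) :
    ∃ d₁ d₂ : Comb S ι, q = (d₁.eval fun i => ucls (f i)) ∧ r = (d₂.eval fun i => ucls (f i)) ∧
      ∀ g : ι → M, d.eval g = d₁.eval g + d₂.eval g := by
  obtain ⟨s, hs, hs'⟩ := exists_representatives d f
  obtain ⟨hq, hr⟩ := QTy.allAtoms_add.1 (h ▸ allAtoms_mem_eval d f)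
  obtain ⟨c₁, hc₁, h₁⟩ := exists_eval_representatives hs hs' hq
  obtain ⟨c₂, hc₂, h₂⟩ := exists_eval_representatives hs hs' hr
  -- `g` need not respect equivalence of the `f i`, so passing to representatives loses `e.eval g -
  -- e.eval (g ∘ s)`. This correction is invisible on types up to zero multiples, so it can be added
  -- one index at a time to whichever summand absorbs it.
  have key : ∀ e : Comb S ι, (∀ i, e.Mem i → d.Mem i) → ∀ (a : S) (c₁ c₂ : Comb S ι),
      (c₁.eval fun i => ucls (f i)) = q → (c₂.eval fun i => ucls (f i)) = r →
      ∃ d₁ d₂ : Comb S ι, (d₁.eval fun i => ucls (f i)) = q ∧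
        (d₂.eval fun i => ucls (f i)) = r ∧ ∀ g : ι → M, d₁.eval g + d₂.eval g =
          c₁.eval g + c₂.eval g + a • (e.eval g + (-1 : S) • e.eval fun i => g (s i)) := by
    intro e
    induction e with
    | pure i =>
      intro hi a c₁ c₂ h₁ h₂
      have hz : a • (ucls (f i) + (-1 : S) • ucls (f (s i))) = (0 : S) • ucls (f i) := by
        rw [(hs i (hi i rfl)).2, add_smul_self, ← mul_smul, add_neg_cancel, mul_zero]
      rcases add_zero_smul_of_mem h (hi i rfl) with hi | hi
      · refine ⟨add c₁ (smul a (add (pure i) (smul (-1) (pure (s i))))), c₂, ?_, h₂, ?_⟩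
        · simp only [eval, hz, h₁, hi]
        · intro g
          simp only [eval]
          exact add_right_comm _ _ _
      · refine ⟨c₁, add c₂ (smul a (add (pure i) (smul (-1) (pure (s i))))), h₁, ?_, ?_⟩
        · simp only [eval, hz, h₂, hi]
        · intro g
          simp only [eval]
          exact (add_assoc _ _ _).symm
    | smul b e ih =>
      intro hi a c₁ c₂ h₁ h₂
      obtain ⟨d₁, d₂, h₁, h₂, h⟩ := ih hi (a * b) c₁ c₂ h₁ h₂
      refine ⟨d₁, d₂, h₁, h₂, fun g => (h g).trans ?_⟩
      simp only [eval, mul_smul, WeakModule.smul_add, smul_comm b (-1 : S)]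
    | add e e' ihe ihe' =>
      intro hi a c₁ c₂ h₁ h₂
      obtain ⟨d₁, d₂, h₁, h₂, h⟩ := ihe (fun i h => hi i (.inl h)) a c₁ c₂ h₁ h₂
      obtain ⟨d₁, d₂, h₁, h₂, h'⟩ := ihe' (fun i h => hi i (.inr h)) a d₁ d₂ h₁ h₂
      refine ⟨d₁, d₂, h₁, h₂, fun g => ?_⟩
      rw [h', h]
      simp only [eval, WeakModule.smul_add]
      ac_rfl
  obtain ⟨d₁, d₂, h₁', h₂', h'⟩ := key d (fun _ => id) 1 c₁ c₂ h₁ h₂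
  refine ⟨d₁, d₂, h₁'.symm, h₂'.symm, fun g => ?_⟩
  -- On representatives `g` and `g ∘ s` agree, and `g ∘ s` does respect equivalence.
  have e₁ : (add c₁ c₂).eval g = d.eval fun i => g (s i) := by
    rw [eval_congr (g' := fun i => g (s i))]
    · refine eval_eq_of_eval_eq (f := f) ?_ fun i j hij => congrArg g (hs' i j hij)
      rw [← h, ← h₁, ← h₂]
      rfl
    · rintro i (hi | hi)
      · rw [(hc₁ i hi).2]
      · rw [(hc₂ i hi).2]
  have e₂ := add_zero_smul_eval (c := d) (d := add c₁ c₂) (by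
    rintro i (hi | hi)
    · exact (hc₁ i hi).1
    · exact (hc₂ i hi).1) g
  rw [h', _root_.one_smul, ← e₁]
  change _ = (add c₁ c₂).eval g + _
  rw [add_add_neg_smul, e₂]

/-- A combination of unit types that equals a multiple `b • q` can be expressed by combinations
that equal `q`. -/
theorem exists_eval_of_smul_eq {b : S} {q : QTy S} {d : Comb S ι} {f : ι → Ty S .unit}
    (h : b • q = d.eval fun i => ucls (f i)) :
    ∃ c c' : Comb S ι, q = (c.eval fun i => ucls (f i)) ∧ q = (c'.eval fun i => ucls (f i)) ∧
      ∀ g : ι → M, d.eval g = b • c.eval g + (c'.eval g + (-1 : S) • c.eval g) := by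
  obtain ⟨s, hs, hs'⟩ := exists_representatives d f
  obtain ⟨c, hc, h₁⟩ := exists_eval_representatives hs hs'
    (QTy.allAtoms_smul.1 (h ▸ allAtoms_mem_eval d f))
  -- `b` need not be cancellable and `d.eval g` may differ from `b • c.eval g`. The difference `d -
  -- b • c` is invisible on types, so `c' = c + (d - b • c)` still represents `q`, and `c' - c`
  -- restores it.
  refine ⟨c, add c (add d (smul (-1) (smul b c))), h₁.symm, ?_, fun g => ?_⟩
  · simp only [eval, ← h, h₁]
    rw [add_smul_self, add_neg_cancel, ← mul_smul, zero_mul, add_zero_smul]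
  have e₂ := add_zero_smul_eval (c := d) (d := c) (fun i hi => (hc i hi).1) g
  simp only [eval]
  have : ∀ x y z w : M, x + (y + (z + w) + (-1 : S) • y) =
      z + (x + w) + (0 : S) • y := by
    intro x y z w
    rw [← add_neg_cancel (1 : S), WeakModule.add_smul, _root_.one_smul]
    ac_rfl
  rw [this, add_smul_self, add_neg_cancel, ← mul_smul, zero_mul, e₂, e₂]

/-- A property of pairs of a scalar and a type that is preserved by linear combinations. -/
structure Closed (P : S → M → Prop) : Prop where
  add {a b : S} {x y : M} : P a x → P b y → P (a + b) (x + y)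
  smul {a : S} {x : M} (b : S) : P a x → P (b * a) (b • x)

theorem Closed.eval {P : S → M → Prop} (hP : Closed P) (c : Comb S ι) {g : ι → M}
    (h : ∀ i, c.Mem i → P 1 (g i)) : P c.total (c.eval g) := by
  induction c with
  | pure i => exact h i rfl
  | smul a c ih => exact hP.smul a (ih h)
  | add c d ihc ihd =>
    exact hP.add (ihc fun i hi => h i (.inl hi)) (ihd fun i hi => h i (.inr hi))

/-- Two ways to write a type as a combination, one of them as a combination of unit types. -/
theorem Closed.transport {P : S → M → Prop} (hP : Closed P) {f : ι → Ty S .unit} {g : ι → M}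
    {R : κ → QTy S} (h : ∀ k (c : Comb S ι), R k = (c.eval fun i => ucls (f i)) → P 1 (c.eval g))
    (e : Comb S κ) (d : Comb S ι) (hd : e.eval R = d.eval fun i => ucls (f i)) :
    P e.total (d.eval g) := by
  induction e generalizing d with
  | pure k => exact h k d hd
  | smul b e ih =>
    obtain ⟨c, c', hc, hc', hg⟩ := exists_eval_of_smul_eq (M := M) hd
    -- The grades add up to `b * e.total + (e.total - e.total)`.
    have := hP.add (hP.smul b (ih c hc)) (hP.add (ih c' hc') (hP.smul (-1) (ih c hc)))
    rw [hg]
    convert this using 1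
    simp [total, Comb.eval]
  | add e e' ihe ihe' =>
    obtain ⟨d₁, d₂, h₁, h₂, hg⟩ := exists_eval_of_add_eq (M := M) hd
    rw [hg]
    exact hP.add (ihe d₁ h₁) (ihe' d₂ h₂)

/-- Every combination can be written as an ordinary linear combination. -/
theorem exists_eq_nsum {S ι : Type*} [CommRing S] (c : Comb S ι) :
    ∃ (n : ℕ) (α : Fin (n + 1) → S) (x : Fin (n + 1) → ι), ∀ (M : Type*) [AddCommSemigroup M]
      [WeakModule S M] (g : ι → M), c.eval g = WeakModule.nsum n fun i => α i • g (x i) := by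
  induction c with
  | pure i =>
    refine ⟨0, fun _ => 1, fun _ => i, ?_⟩
    intro M _ _ g
    exact (_root_.one_smul S (g i)).symm
  | smul a c ih =>
    obtain ⟨n, α, x, h⟩ := ih
    refine ⟨n, fun i => a * α i, x, ?_⟩
    intro M _ _ g
    simp only [eval, h, smul_nsum, mul_smul]
  | add c d ihc ihd =>
    obtain ⟨n, α, x, hc⟩ := ihc
    obtain ⟨m, β, y, hd⟩ := ihd
    have : ∀ (m : ℕ) (β : Fin (m + 1) → S) (y : Fin (m + 1) → ι),
        ∃ (n' : ℕ) (γ : Fin (n' + 1) → S) (z : Fin (n' + 1) → ι),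
        ∀ (M : Type _) [AddCommSemigroup M] [WeakModule S M] (g : ι → M),
          WeakModule.nsum n (fun i => α i • g (x i)) + WeakModule.nsum m (fun i => β i • g (y i)) =
            WeakModule.nsum n' fun i => γ i • g (z i) := by
      intro m
      induction m with
      | zero =>
        intro β y
        refine ⟨n + 1, Fin.snoc (α := fun _ => S) α (β 0), Fin.snoc (α := fun _ => ι) x (y 0), ?_⟩
        intro M _ _ g
        simp [WeakModule.nsum]
      | succ m ih =>
        intro β y
        obtain ⟨n', γ, z, h⟩ := ih (fun i => β i.castSucc) (fun i => y i.castSucc)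
        refine ⟨n' + 1, Fin.snoc (α := fun _ => S) γ (β (Fin.last (m + 1))),
          Fin.snoc (α := fun _ => ι) z (y (Fin.last (m + 1))), ?_⟩
        intro M _ _ g
        simp [WeakModule.nsum, ← h, ← add_assoc]
    obtain ⟨n', γ, z, h⟩ := this m β y
    refine ⟨n', γ, z, ?_⟩
    intro M _ _ g
    rw [eval, hc, hd, h]

end Comb

section

variable {S : Type u} [CommRing S]

/-! ### Graded typing -/

/-- `Graded Γ a t q` says that `a · t` has type `q` in `Γ`. Types are taken modulo equivalence. -/
inductive Graded : Ctx S → S → Term S → QTy S → Prop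
  | ax {Γ : Ctx S} {n : ℕ} {U : Ty S .unit} : Γ[n]? = some U → Graded Γ 1 (.var n) (ucls U)
  | arrowI {Γ : Ctx S} {U : Ty S .unit} {t : Term S} {T : Ty S .gen} :
      Graded (U :: Γ) 1 t (cls T) → Graded Γ 1 (.lam t) (ucls (.arrow U T))
  | arrowE {Γ : Ctx S} {t r : Term S} {ι κ : Type} (c : Comb S ι) (d : Comb S κ)
      (ks : List Sort2) (U : Ty S .unit) (T : ι → Ty S .gen)
      (A : κ → List (Σ k : Sort2, Ty S k)) :
      (∀ j, (A j).map Sigma.fst = ks) →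
      Graded Γ 1 t (c.eval fun i => ucls (Ty.alls ks (.arrow U (T i)))) →
      Graded Γ 1 r (d.eval fun j => ucls (U.inst (A j))) →
      Graded Γ 1 (.app t r) (c.eval fun i => d.eval fun j => cls ((T i).inst (A j)))
  | addI {Γ : Ctx S} {t r : Term S} {p q : QTy S} :
      Graded Γ 1 t p → Graded Γ 1 r q → Graded Γ 1 (.add t r) (p + q)
  | smulI {Γ : Ctx S} {t : Term S} {a : S} {q : QTy S} :
      Graded Γ a t q → Graded Γ 1 (.smul a t) q
  | add {Γ : Ctx S} {t : Term S} {a b : S} {p q : QTy S} :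
      Graded Γ a t p → Graded Γ b t q → Graded Γ (a + b) t (p + q)
  | smul {Γ : Ctx S} {t : Term S} {a : S} {q : QTy S} (b : S) :
      Graded Γ a t q → Graded Γ (b * a) t (b • q)
  | allI {Γ : Ctx S} {t : Term S} {a : S} {ι : Type} (k : Sort2) (c : Comb S ι)
      (U : ι → Ty S .unit) :
      Graded (Γ.shift k) a t (c.eval fun i => ucls (U i)) →
      Graded Γ a t (c.eval fun i => ucls (.all k (U i)))
  | allE {Γ : Ctx S} {t : Term S} {a : S} {ι : Type} (k : Sort2) (c : Comb S ι)
      (U : ι → Ty S .unit) (A : Ty S k) :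
      Graded Γ a t (c.eval fun i => ucls (.all k (U i))) →
      Graded Γ a t (c.eval fun i => ucls ((U i).inst [⟨k, A⟩]))

/-! ### Inversion of graded typing -/

namespace Graded

theorem closed (Γ : Ctx S) (t : Term S) : Comb.Closed fun a q => Graded Γ a t q :=
  ⟨Graded.add, Graded.smul⟩

theorem congr {Γ : Ctx S} {t : Term S} {a b : S} {p q : QTy S} (h : Graded Γ a t p) (hab : a = b)
    (hpq : p = q) : Graded Γ b t q := hab ▸ hpq ▸ h

/-- Only `smulI` inspects the scalar in the term; the remaining applicable rules hold at any grade
and commute with multiplication by `a`. -/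
theorem of_smul {Γ : Ctx S} {t : Term S} {a b : S} {q : QTy S} (h : Graded Γ b (.smul a t) q) :
    Graded Γ (b * a) t q := by
  generalize ht : Term.smul a t = s at h
  induction h with
  | ax => cases ht
  | arrowI => cases ht
  | arrowE => cases ht
  | addI => cases ht
  | smulI h _ =>
    cases ht
    rwa [one_mul]
  | add _ _ ih₁ ih₂ => exact ((ih₁ ht).add (ih₂ ht)).congr (add_mul _ _ _).symm rfl
  | smul b _ ih => exact ((ih ht).smul b).congr (mul_assoc _ _ _).symm rfl
  | allI k c U _ ih => exact (ih ht).allI k c U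
  | allE k c U A _ ih => exact (ih ht).allE k c U A

/-- In the quantifier cases the displayed combination is split along the two summands given by
induction. -/
theorem exists_of_add {Γ : Ctx S} {t r : Term S} {a : S} {q : QTy S}
    (h : Graded Γ a (.add t r) q) :
    ∃ q₁ q₂ : QTy S, q = q₁ + q₂ ∧ Graded Γ a t q₁ ∧ Graded Γ a r q₂ := by
  generalize ht : Term.add t r = s at h
  induction h with
  | ax => cases ht
  | arrowI => cases ht
  | arrowE => cases ht
  | addI h₁ h₂ _ _ =>
    cases ht
    exact ⟨_, _, rfl, h₁, h₂⟩
  | smulI => cases ht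
  | add _ _ ih₁ ih₂ =>
    obtain ⟨p₁, p₂, rfl, h₁, h₂⟩ := ih₁ ht
    obtain ⟨q₁, q₂, rfl, h₁', h₂'⟩ := ih₂ ht
    exact ⟨_, _, add_add_add_comm _ _ _ _, h₁.add h₁', h₂.add h₂'⟩
  | smul b _ ih =>
    obtain ⟨q₁, q₂, rfl, h₁, h₂⟩ := ih ht
    exact ⟨_, _, smul_add _ _ _, h₁.smul b, h₂.smul b⟩
  | allI k c U _ ih =>
    obtain ⟨q₁, q₂, h, h₁, h₂⟩ := ih ht
    obtain ⟨c₁, c₂, rfl, rfl, hc⟩ := Comb.exists_eval_of_add_eq (M := QTy S) h.symm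
    exact ⟨_, _, hc _, h₁.allI k c₁ U, h₂.allI k c₂ U⟩
  | allE k c U A _ ih =>
    obtain ⟨q₁, q₂, h, h₁, h₂⟩ := ih ht
    obtain ⟨c₁, c₂, rfl, rfl, hc⟩ := Comb.exists_eval_of_add_eq (M := QTy S) h.symm
    exact ⟨_, _, hc _, h₁.allE k c₁ U A, h₂.allE k c₂ U A⟩

/-- The premises of the rule for the head constructor of a term. -/
def Head (Γ : Ctx S) : Term S → QTy S → Prop
  | .var n, q => ∃ U, Γ[n]? = some U ∧ q = ucls U
  | .lam t, q => ∃ U T, Graded (U :: Γ) 1 t (cls T) ∧ q = ucls (.arrow U T)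
  | .app t r, q => ∃ (ι κ : Type) (c : Comb S ι) (d : Comb S κ) (ks : List Sort2)
      (U : Ty S .unit) (T : ι → Ty S .gen) (A : κ → List (Σ k : Sort2, Ty S k)),
      (∀ j, (A j).map Sigma.fst = ks) ∧
      Graded Γ 1 t (c.eval fun i => ucls (Ty.alls ks (.arrow U (T i)))) ∧
      Graded Γ 1 r (d.eval fun j => ucls (U.inst (A j))) ∧
      q = c.eval fun i => d.eval fun j => cls ((T i).inst (A j))
  | .smul a t, q => Graded Γ a t q
  | .add t r, q => ∃ q₁ q₂, Graded Γ 1 t q₁ ∧ Graded Γ 1 r q₂ ∧ q = q₁ + q₂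

/-- To transfer the types of `t` to `t'`, it is enough to consider the typings of `t` that end
with the rule for its head constructor. -/
theorem transfer {t t' : Term S} (h : ∀ Γ q, Head Γ t q → Graded Γ 1 t' q) {Γ : Ctx S} {a : S}
    {q : QTy S} (ht : Graded Γ a t q) : Graded Γ a t' q := by
  induction ht with
  | ax hU => exact h _ _ ⟨_, hU, rfl⟩
  | arrowI ht _ => exact h _ _ ⟨_, _, ht, rfl⟩
  | arrowE c d ks U T A hA ht hr _ _ => exact h _ _ ⟨_, _, c, d, ks, U, T, A, hA, ht, hr, rfl⟩
  | addI ht hr _ _ => exact h _ _ ⟨_, _, ht, hr, rfl⟩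
  | smulI ht _ => exact h _ _ ht
  | add _ _ ih₁ ih₂ => exact (ih₁ h).add (ih₂ h)
  | smul b _ ih => exact (ih h).smul b
  | allI k c U _ ih => exact (ih h).allI k c U
  | allE k c U A _ ih => exact (ih h).allE k c U A

end Graded

/-! ### Equivalence of the two notions of typing -/

namespace Typing

variable {Γ : Ctx S} {t r : Term S}

theorem of_cls_eq {T R : Ty S .gen} (h : Typing Γ t T) (hTR : cls T = cls R) : Typing Γ t R :=
  h.equiv (cls_eq_iff.1 hTR.symm)

/-- Typing of `t` with a class of types. -/
def QTyping (Γ : Ctx S) (t : Term S) (q : QTy S) : Prop := ∃ T, cls T = q ∧ Typing Γ t T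

theorem qTyping_cls {T : Ty S .gen} : QTyping Γ t (cls T) ↔ Typing Γ t T :=
  ⟨fun ⟨_, hR, h⟩ => h.of_cls_eq hR, fun h => ⟨T, rfl, h⟩⟩

theorem cls_smul_sum {n : ℕ} (α : Fin (n + 1) → S) (T : Fin (n + 1) → Ty S .gen) :
    cls (Ty.sum n fun i => .smul (α i) (T i)) = nsum n fun i => α i • cls (T i) :=
  cls_sum _ _

/-- The class `q` is a linear combination, with sum of coefficients `a`, of types of `t`. -/
def Decomp (Γ : Ctx S) (a : S) (t : Term S) (q : QTy S) : Prop :=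
  ∃ c : Comb S {T : Ty S .gen // Typing Γ t T}, c.total = a ∧ (c.eval fun T => cls T.1) = q

theorem decomp_closed (Γ : Ctx S) (t : Term S) : Comb.Closed fun a q => Decomp Γ a t q where
  add := by
    rintro _ _ _ _ ⟨c, rfl, rfl⟩ ⟨d, rfl, rfl⟩
    exact ⟨.add c d, rfl, rfl⟩
  smul := by
    rintro _ _ b ⟨c, rfl, rfl⟩
    exact ⟨.smul b c, rfl, rfl⟩

theorem QTyping.decomp {q : QTy S} (h : QTyping Γ t q) : Decomp Γ 1 t q := by
  obtain ⟨T, rfl, h⟩ := h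
  exact ⟨.pure ⟨T, h⟩, rfl, rfl⟩

theorem Decomp.qTyping_smul {a : S} {q : QTy S} (h : Decomp Γ a t q) :
    QTyping Γ (.smul a t) q := by
  obtain ⟨c, rfl, rfl⟩ := h
  -- The expansion is used twice: in `S`, for the sum of the coefficients, and in `QTy S`, for the
  -- type.
  obtain ⟨n, α, x, hc⟩ := c.exists_eq_nsum
  have htotal : c.total = ∑ i, α i := by
    rw [Comb.total, hc, nsum_eq_sum]
    simp
  rw [htotal, hc]
  exact ⟨_, cls_smul_sum _ _, Typing.sumI α (fun i => (x i).1) fun i => (x i).2⟩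

/-- Rule (S) types `1 · t` with the combination, and (1_E) removes the scalar. -/
theorem Decomp.qTyping {q : QTy S} (h : Decomp Γ 1 t q) : QTyping Γ t q := by
  obtain ⟨T, hT, h⟩ := h.qTyping_smul
  exact ⟨T, hT, h.oneE⟩

theorem QTyping.allI {ι : Type*} {k : Sort2} {c : Comb S ι} {U : ι → Ty S .unit}
    (h : QTyping (Γ.shift k) t (c.eval fun i => ucls (U i))) :
    QTyping Γ t (c.eval fun i => ucls (.all k (U i))) := by
  obtain ⟨n, α, x, hc⟩ := c.exists_eq_nsum
  rw [hc] at h ⊢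
  refine ⟨_, cls_smul_sum _ _, Typing.allI k α (fun i => U (x i)) (qTyping_cls.1 ?_)⟩
  rwa [cls_smul_sum]

theorem QTyping.allE {ι : Type*} {k : Sort2} {c : Comb S ι} {U : ι → Ty S .unit} (A : Ty S k)
    (h : QTyping Γ t (c.eval fun i => ucls (.all k (U i)))) :
    QTyping Γ t (c.eval fun i => ucls ((U i).inst [⟨k, A⟩])) := by
  obtain ⟨n, α, x, hc⟩ := c.exists_eq_nsum
  rw [hc] at h ⊢
  refine ⟨_, cls_smul_sum _ _, Typing.allE k α (fun i => U (x i)) A (qTyping_cls.1 ?_)⟩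
  rwa [cls_smul_sum]

theorem QTyping.arrowE {ι κ : Type*} {c : Comb S ι} {d : Comb S κ} {ks : List Sort2}
    {U : Ty S .unit} {T : ι → Ty S .gen} {A : κ → List (Σ k : Sort2, Ty S k)}
    (hA : ∀ j, (A j).map Sigma.fst = ks)
    (ht : QTyping Γ t (c.eval fun i => ucls (Ty.alls ks (.arrow U (T i)))))
    (hr : QTyping Γ r (d.eval fun j => ucls (U.inst (A j)))) :
    QTyping Γ (.app t r) (c.eval fun i => d.eval fun j => cls ((T i).inst (A j))) := by
  obtain ⟨n, α, x, hc⟩ := c.exists_eq_nsum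
  obtain ⟨m, β, y, hd⟩ := d.exists_eq_nsum
  rw [hc] at ht ⊢
  replace hd := fun g => hd (QTy S) g
  simp only [hd] at hr ⊢
  refine ⟨_, ?_, Typing.arrowE α β ks U (fun i => T (x i)) (fun j => A (y j)) (fun j => hA _)
    (qTyping_cls.1 ?_) (qTyping_cls.1 ?_)⟩
  · rw [cls_sum]
    simp only [cls_smul_sum, smul_nsum, mul_smul]
  · rwa [cls_smul_sum]
  · rwa [cls_smul_sum]

end Typing

open Typing in
-- A quantifier rule at grade `a` is simulated by applying the ordinary rule to each summand;
-- `transport` matches the summands with the displayed unit types.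
theorem Graded.decomp {Γ : Ctx S} {a : S} {t : Term S} {q : QTy S} (h : Graded Γ a t q) :
    Decomp Γ a t q := by
  induction h with
  | ax hU => exact QTyping.decomp ⟨_, rfl, Typing.ax hU⟩
  | arrowI _ ih => exact QTyping.decomp ⟨_, rfl, Typing.arrowI (qTyping_cls.1 ih.qTyping)⟩
  | arrowE c d ks U T A hA _ _ ih₁ ih₂ => exact (QTyping.arrowE hA ih₁.qTyping ih₂.qTyping).decomp
  | addI _ _ ih₁ ih₂ =>
    obtain ⟨T, rfl, h₁⟩ := ih₁.qTyping
    obtain ⟨R, rfl, h₂⟩ := ih₂.qTyping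
    exact QTyping.decomp ⟨_, rfl, h₁.addI h₂⟩
  | smulI _ ih => exact ih.qTyping_smul.decomp
  | add _ _ ih₁ ih₂ => exact (decomp_closed _ _).add ih₁ ih₂
  | smul b _ ih => exact (decomp_closed _ _).smul b ih
  | allI k c U _ ih =>
    obtain ⟨e, rfl, he⟩ := ih
    exact (decomp_closed _ _).transport
      (fun T c' hc' => QTyping.decomp (QTyping.allI ⟨T.1, hc', T.2⟩)) e c he
  | allE k c U A _ ih =>
    obtain ⟨e, rfl, he⟩ := ih
    exact (decomp_closed _ _).transport
      (fun T c' hc' => QTyping.decomp (QTyping.allE A ⟨T.1, hc', T.2⟩)) e c he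

theorem Graded.typing {Γ : Ctx S} {t : Term S} {T : Ty S .gen} (h : Graded Γ 1 t (cls T)) :
    Typing Γ t T :=
  Typing.qTyping_cls.1 h.decomp.qTyping

/-- The formal linear combination with the given coefficients. -/
def Comb.ofFn (n : ℕ) (α : Fin (n + 1) → S) : Comb S (Fin (n + 1)) :=
  Comb.nsum n fun i => .smul (α i) (.pure i)

theorem Typing.cls_smul_sum_eq_eval {n : ℕ} (α : Fin (n + 1) → S) (T : Fin (n + 1) → Ty S .gen) :
    cls (Ty.sum n fun i => .smul (α i) (T i)) = (Comb.ofFn n α).eval fun i => cls (T i) := by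
  rw [cls_smul_sum, Comb.ofFn, Comb.eval_nsum]
  rfl

theorem Comb.total_ofFn {n : ℕ} (α : Fin (n + 1) → S) : (Comb.ofFn n α).total = ∑ i, α i := by
  rw [Comb.total, Comb.ofFn, Comb.eval_nsum, nsum_eq_sum]
  simp [Comb.eval]

theorem Typing.graded {Γ : Ctx S} {t : Term S} {T : Ty S .gen} (h : Typing Γ t T) :
    Graded Γ 1 t (cls T) := by
  induction h with
  | ax hU => exact .ax hU
  | equiv _ hR ih => exact ih.congr rfl hR.symm.cls_eq
  | arrowI _ ih => exact .arrowI ih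
  | arrowE α β ks U T A hA _ _ ih₁ ih₂ =>
    rw [cls_smul_sum_eq_eval] at ih₁ ih₂
    refine (Graded.arrowE _ _ ks U T A hA ih₁ ih₂).congr rfl ?_
    simp only [cls_sum, cls_smul, Comb.ofFn, Comb.eval_nsum, Comb.eval, smul_nsum, mul_smul]
  | allI k α U _ ih =>
    rw [cls_smul_sum_eq_eval] at ih ⊢
    exact ih.allI k _ U
  | allE k α U A _ ih =>
    rw [cls_smul_sum_eq_eval] at ih ⊢
    exact ih.allE k _ U A
  | addI _ _ ih₁ ih₂ => exact ih₁.addI ih₂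
  | oneE _ ih => exact ih.of_smul.congr (one_mul 1) rfl
  | sumI α T _ ih =>
    rw [cls_smul_sum_eq_eval, ← Comb.total_ofFn]
    exact .smulI ((Graded.closed _ _).eval _ fun i _ => ih i)

end

section

variable {S : Type u}

/-! ### Substitution lemmas -/

theorem Ctx.getElem?_subst {Γ : Ctx S} {n : ℕ} {V : Ty S .unit}
    (σ : (l : Sort2) → ℕ → Ty S l) (h : (Ctx.subst σ Γ)[n]? = some V) :
    ∃ U, Γ[n]? = some U ∧ U.subst σ = V := by
  rw [Ctx.subst, List.getElem?_map] at h
  exact Option.map_eq_some_iff.1 h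

theorem Term.rename_id (t : Term S) : t.rename id = t := by
  have : Term.upRen id = id := by
    funext n
    cases n <;> rfl
  induction t with
  | var n => rfl
  | lam t ih => rw [Term.rename, this, ih]
  | app t r iht ihr => rw [Term.rename, iht, ihr]
  | smul a t ih => rw [Term.rename, ih]
  | add t r iht ihr => rw [Term.rename, iht, ihr]

variable [CommRing S]

namespace Graded

theorem subst {Γ : Ctx S} {a : S} {t : Term S} {q : QTy S} (h : Graded Γ a t q)
    (σ : (l : Sort2) → ℕ → Ty S l) : Graded (Ctx.subst σ Γ) a t (q.subst σ) := by
  induction h generalizing σ with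
  | @ax Γ n U hU => exact .ax (by rw [Ctx.subst, List.getElem?_map, hU]; rfl)
  | arrowI _ ih => exact .arrowI (ih σ)
  | arrowE c d ks U T A hA _ _ ih₁ ih₂ =>
    have h₁ := ih₁ σ
    have h₂ := ih₂ σ
    simp only [Comb.subst_eval, QTy.subst_ucls, QTy.subst_cls, Ty.subst_alls, Ty.subst_inst, hA,
      Ty.subst] at h₁ h₂ ⊢
    exact .arrowE c d ks _ _ (fun j => Ty.substList σ (A j))
      (fun j => (Ty.map_fst_substList _ _).trans (hA j)) h₁ h₂
  | addI _ _ ih₁ ih₂ =>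
    rw [QTy.subst_add]
    exact (ih₁ σ).addI (ih₂ σ)
  | smulI _ ih => exact .smulI (ih σ)
  | add _ _ ih₁ ih₂ =>
    rw [QTy.subst_add]
    exact (ih₁ σ).add (ih₂ σ)
  | smul b _ ih =>
    rw [QTy.subst_smul]
    exact (ih σ).smul b
  | allI k c U _ ih =>
    have h := ih (Ty.upSubst k σ)
    rw [Ctx.subst_shift] at h
    rw [Comb.subst_eval] at h ⊢
    exact .allI k c _ h
  | allE k c U A _ ih =>
    have h := ih σ
    simp only [Comb.subst_eval, QTy.subst_ucls, Ty.subst_inst_singleton, Ty.subst] at h ⊢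
    exact .allE k c _ _ h

/-- Context types need to match only up to equivalence, so that the identity renaming yields
`cons_congr`. -/
theorem rename {Γ : Ctx S} {a : S} {t : Term S} {q : QTy S} (h : Graded Γ a t q) {ρ : ℕ → ℕ}
    {Δ : Ctx S} (hρ : ∀ n U, Γ[n]? = some U → ∃ V, Δ[ρ n]? = some V ∧ ucls V = ucls U) :
    Graded Δ a (t.rename ρ) q := by
  induction h generalizing ρ Δ with
  | ax hU =>
    obtain ⟨V, hV, h⟩ := hρ _ _ hU
    exact (Graded.ax hV).congr rfl h
  | arrowI _ ih =>
    refine .arrowI (ih ?_)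
    rintro (_ | n) U hU
    · exact ⟨_, rfl, congrArg ucls (Option.some.inj hU)⟩
    · exact hρ n U hU
  | arrowE c d ks U T A hA _ _ ih₁ ih₂ => exact .arrowE c d ks U T A hA (ih₁ hρ) (ih₂ hρ)
  | addI _ _ ih₁ ih₂ => exact (ih₁ hρ).addI (ih₂ hρ)
  | smulI _ ih => exact .smulI (ih hρ)
  | add _ _ ih₁ ih₂ => exact (ih₁ hρ).add (ih₂ hρ)
  | smul b _ ih => exact (ih hρ).smul b
  | allI k c U _ ih =>
    refine .allI k c U (ih ?_)
    intro n W' hW'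
    rw [Ctx.shift_eq_subst] at hW' ⊢
    obtain ⟨W, hW, rfl⟩ := Ctx.getElem?_subst _ hW'
    obtain ⟨V, hV, h⟩ := hρ n W hW
    exact ⟨_, by rw [Ctx.subst, List.getElem?_map, hV]; rfl, ucls_subst_congr _ h⟩
  | allE k c U A _ ih => exact (ih hρ).allE k c U A

theorem shift {Γ : Ctx S} {a : S} {t : Term S} {U : Ty S .unit} (h : Graded Γ a t (ucls U))
    (k : Sort2) : Graded (Γ.shift k) a t (ucls (U.rename (Ty.shift k))) := by
  rw [Ctx.shift_eq_subst, Ty.rename_eq_subst]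
  exact h.subst _

theorem substTerm {Γ : Ctx S} {a : S} {t : Term S} {q : QTy S} (h : Graded Γ a t q)
    {σ : ℕ → Term S} {Δ : Ctx S} (hσ : ∀ n U, Γ[n]? = some U → Graded Δ 1 (σ n) (ucls U)) :
    Graded Δ a (t.subst σ) q := by
  induction h generalizing σ Δ with
  | ax hU => exact hσ _ _ hU
  | arrowI _ ih =>
    refine .arrowI (ih ?_)
    rintro (_ | n) U hU
    · exact .ax hU
    · exact (hσ n U hU).rename fun m V hV => ⟨V, hV, rfl⟩
  | arrowE c d ks U T A hA _ _ ih₁ ih₂ => exact .arrowE c d ks U T A hA (ih₁ hσ) (ih₂ hσ)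
  | addI _ _ ih₁ ih₂ => exact (ih₁ hσ).addI (ih₂ hσ)
  | smulI _ ih => exact .smulI (ih hσ)
  | add _ _ ih₁ ih₂ => exact (ih₁ hσ).add (ih₂ hσ)
  | smul b _ ih => exact (ih hσ).smul b
  | allI k c U _ ih =>
    refine .allI k c U (ih ?_)
    intro n W hW
    obtain ⟨V, hV, rfl⟩ := Option.map_eq_some_iff.1 ((List.getElem?_map).symm.trans hW)
    exact (hσ n V hV).shift k
  | allE k c U A _ ih => exact (ih hσ).allE k c U A

end Graded

namespace Graded

theorem cons_congr {Γ : Ctx S} {a : S} {t : Term S} {q : QTy S} {U V : Ty S .unit}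
    (h : Graded (U :: Γ) a t q) (hUV : ucls U = ucls V) : Graded (V :: Γ) a t q := by
  rw [← t.rename_id]
  refine h.rename ?_
  rintro (_ | n) W hW
  · exact ⟨V, rfl, hUV.symm.trans (congrArg ucls (Option.some.inj hW))⟩
  · exact ⟨W, hW, rfl⟩

theorem inst {Γ : Ctx S} {a : S} {t b : Term S} {q : QTy S} {U : Ty S .unit}
    (h : Graded (U :: Γ) a t q) (hb : Graded Γ 1 b (ucls U)) : Graded Γ a (t.inst b) q := by
  refine h.substTerm ?_
  rintro (_ | n) W hW
  · exact hb.congr rfl (congrArg ucls (Option.some.inj hW))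
  · exact .ax hW

/-! ### Types of basis terms and of abstractions -/

/-- No head rule for a basis term introduces a scalar, and the quantifier rules keep all
coefficients. -/
theorem total_of_isBasis {Γ : Ctx S} {a : S} {b : Term S} {q : QTy S} (h : Graded Γ a b q)
    (hb : b.IsBasis) : q.total = a := by
  induction h with
  | ax => rfl
  | arrowI => rfl
  | arrowE => cases hb
  | addI => cases hb
  | smulI => cases hb
  | add _ _ ih₁ ih₂ => rw [QTy.total_add, ih₁ hb, ih₂ hb]
  | smul b _ ih => rw [QTy.total_smul, ih hb]
  | allI k c U _ ih =>
    rw [← ih hb, Comb.total_eval, Comb.total_eval]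
  | allE k c U A _ ih =>
    rw [← ih hb, Comb.total_eval, Comb.total_eval]

theorem allAtoms_of_isBasis {Γ : Ctx S} {a : S} {b : Term S} {q : QTy S} (h : Graded Γ a b q)
    (hb : b.IsBasis) : QTy.AllAtoms (Graded Γ 1 b) q := by
  induction h with
  | ax hU => exact .ax hU
  | arrowI h _ => exact .arrowI h
  | arrowE => cases hb
  | addI => cases hb
  | smulI => cases hb
  | add _ _ ih₁ ih₂ => exact QTy.allAtoms_add.2 ⟨ih₁ hb, ih₂ hb⟩
  | smul b _ ih => exact QTy.allAtoms_smul.2 (ih hb)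
  | allI k c U _ ih =>
    refine (Comb.allAtoms_eval _ _).2 fun i hi => ?_
    have := (Comb.allAtoms_eval _ _).1 (ih hb) i hi
    exact .allI k (.pure ()) (fun _ => U i) this
  | allE k c U A _ ih =>
    refine (Comb.allAtoms_eval _ _).2 fun i hi => ?_
    have := (Comb.allAtoms_eval _ _).1 (ih hb) i hi
    exact .allE k (.pure ()) (fun _ => U i) A this

/-- The unit types of the abstraction `λx.t` that are obtained by generalizing an arrow type. -/
def IsLamType (Γ : Ctx S) (t : Term S) (q : QTy S) : Prop :=
  ∃ (ks : List Sort2) (U : Ty S .unit) (T : Ty S .gen), q = ucls (Ty.alls ks (.arrow U T)) ∧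
    Graded (U :: Ctx.shifts ks Γ) 1 t (cls T)

theorem allAtoms_of_lam {Γ : Ctx S} {a : S} {t : Term S} {q : QTy S} (h : Graded Γ a (.lam t) q) :
    QTy.AllAtoms (IsLamType Γ t) q := by
  generalize ht : Term.lam t = s at h
  induction h with
  | ax => cases ht
  | arrowI h _ =>
    cases ht
    exact ⟨[], _, _, rfl, h⟩
  | arrowE => cases ht
  | addI => cases ht
  | smulI => cases ht
  | add _ _ ih₁ ih₂ => exact QTy.allAtoms_add.2 ⟨ih₁ ht, ih₂ ht⟩
  | smul b _ ih => exact QTy.allAtoms_smul.2 (ih ht)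
  | allI k c U _ ih =>
    refine (Comb.allAtoms_eval _ _).2 fun i hi => ?_
    obtain ⟨ks, W, T, hU, h⟩ := (Comb.allAtoms_eval _ _).1 (ih ht) i hi
    exact ⟨k :: ks, W, T, ucls_all_congr k hU, h⟩
  | @allE Γ _ _ _ k c U A _ ih =>
    refine (Comb.allAtoms_eval _ _).2 fun i hi => ?_
    obtain ⟨_ | ⟨k', ks⟩, W, T, hU, h⟩ := (Comb.allAtoms_eval _ _).1 (ih ht) i hi
    · exact absurd hU ucls_all_ne_arrow
    · obtain ⟨rfl, hUV⟩ := ucls_all_inj hU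
      -- `A` replaces the outermost quantified variable, so the substitution has to pass under the
      -- remaining binders `ks`.
      have h := h.subst (Ty.upSubsts ks (Ty.substOf [⟨k, A⟩]))
      have hΓ : Ctx.subst (Ty.upSubsts ks (Ty.substOf [⟨k, A⟩])) (Ctx.shifts (k :: ks) Γ) =
          Ctx.shifts ks Γ :=
        (Ctx.subst_upSubsts_shifts ks _ _).trans
          (congrArg _ (Ctx.subst_substOf_shifts [⟨k, A⟩] _))
      rw [Ctx.subst, List.map_cons, ← Ctx.subst, hΓ] at h
      refine ⟨ks, _, _, ?_, h⟩
      exact (ucls_subst_congr _ hUV).trans (congrArg ucls (Ty.subst_alls ks _ _))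

/-- Each pair of atoms, one of the abstraction and one of `b`, types `t[b/x]` by the two
substitution lemmas; both coefficient sums are `1`, so the combination has grade `1`. -/
theorem beta {Γ : Ctx S} {a : S} {t b : Term S} {q : QTy S} (h : Graded Γ a (.app (.lam t) b) q)
    (hb : b.IsBasis) : Graded Γ a (t.inst b) q := by
  refine h.transfer ?_
  rintro Γ q ⟨ι, κ, c, d, ks, U, T, A, hA, ht, hr, rfl⟩
  have hc : c.total = 1 := (Comb.total_eval _ _).symm.trans (ht.total_of_isBasis (.lam t))
  have hd : d.total = 1 := (Comb.total_eval _ _).symm.trans (hr.total_of_isBasis hb)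
  have ht := (Comb.allAtoms_eval _ _).1 ht.allAtoms_of_lam
  have hr := (Comb.allAtoms_eval _ _).1 (hr.allAtoms_of_isBasis hb)
  refine (((closed _ _).eval c fun i hi => ?_)).congr hc rfl
  refine (((closed _ _).eval d fun j hj => ?_)).congr hd rfl
  obtain ⟨ks', V, R, hV, h⟩ := ht i hi
  obtain ⟨rfl, hUV, hTR⟩ := ucls_alls_arrow_inj hV
  have h := ((h.cons_congr hUV.symm).congr rfl hTR.symm).subst (Ty.substOf (A j))
  refine inst (U := U.inst (A j)) ?_ (hr j hj)
  have hΓ := Ctx.subst_substOf_shifts (A j) Γ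
  rw [hA] at hΓ
  rw [Ctx.subst, List.map_cons, ← Ctx.subst, hΓ] at h
  exact h

/-! ### Application to linear combinations -/

/-- The function type is decomposed into ordinary types of `t`, to each of which `arrowE` applies at
grade `1`. -/
theorem app_left {Γ : Ctx S} {a : S} {t r : Term S} {ι κ : Type} {c : Comb S ι} {d : Comb S κ}
    {ks : List Sort2} {U : Ty S .unit} {T : ι → Ty S .gen}
    {A : κ → List (Σ k : Sort2, Ty S k)} (hA : ∀ j, (A j).map Sigma.fst = ks)
    (ht : Graded Γ a t (c.eval fun i => ucls (Ty.alls ks (.arrow U (T i)))))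
    (hr : Graded Γ 1 r (d.eval fun j => ucls (U.inst (A j)))) :
    Graded Γ a (.app t r) (c.eval fun i => d.eval fun j => cls ((T i).inst (A j))) := by
  obtain ⟨e, rfl, he⟩ := ht.decomp
  refine (closed _ _).transport (fun R c' hc' => ?_) e c he
  exact .arrowE c' d ks U T A hA (hc' ▸ R.2.graded) hr

/-- Here `transport` must tolerate incompatible values: `U[A⃗ⱼ]` does not determine `T[A⃗ⱼ]` when a
bound variable is absent from `U`. -/
theorem app_right {Γ : Ctx S} {a : S} {t r : Term S} {ι κ : Type} {c : Comb S ι} {d : Comb S κ}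
    {ks : List Sort2} {U : Ty S .unit} {T : ι → Ty S .gen}
    {A : κ → List (Σ k : Sort2, Ty S k)} (hA : ∀ j, (A j).map Sigma.fst = ks)
    (ht : Graded Γ 1 t (c.eval fun i => ucls (Ty.alls ks (.arrow U (T i)))))
    (hr : Graded Γ a r (d.eval fun j => ucls (U.inst (A j)))) :
    Graded Γ a (.app t r) (c.eval fun i => d.eval fun j => cls ((T i).inst (A j))) := by
  obtain ⟨e, rfl, he⟩ := hr.decomp
  -- The combination to be decomposed, `d`, has to be outermost.
  rw [Comb.eval_comm]
  refine (closed _ _).transport (fun R d' hd' => ?_) e d he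
  rw [← Comb.eval_comm]
  exact .arrowE c d' ks U T A hA ht (hd' ▸ R.2.graded)

/-! ### Congruence -/

theorem lam_congr {t t' : Term S}
    (h : ∀ Γ a q, Graded Γ a t q → Graded Γ a t' q) {Γ : Ctx S} {a : S} {q : QTy S}
    (ht : Graded Γ a (.lam t) q) : Graded Γ a (.lam t') q := by
  refine ht.transfer ?_
  rintro Γ q ⟨U, T, ht, rfl⟩
  exact .arrowI (h _ _ _ ht)

theorem app_congr {t t' r r' : Term S}
    (h : ∀ Γ a q, Graded Γ a t q → Graded Γ a t' q)
    (h' : ∀ Γ a q, Graded Γ a r q → Graded Γ a r' q) {Γ : Ctx S} {a : S} {q : QTy S}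
    (ht : Graded Γ a (.app t r) q) : Graded Γ a (.app t' r') q := by
  refine ht.transfer ?_
  rintro Γ q ⟨ι, κ, c, d, ks, U, T, A, hA, ht, hr, rfl⟩
  exact .arrowE c d ks U T A hA (h _ _ _ ht) (h' _ _ _ hr)

theorem smul_congr {t t' : Term S} {b : S}
    (h : ∀ Γ a q, Graded Γ a t q → Graded Γ a t' q) {Γ : Ctx S} {a : S} {q : QTy S}
    (ht : Graded Γ a (.smul b t) q) : Graded Γ a (.smul b t') q := by
  refine ht.transfer ?_
  intro Γ q ht
  exact .smulI (h _ _ _ ht)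

theorem add_congr {t t' r r' : Term S}
    (h : ∀ Γ a q, Graded Γ a t q → Graded Γ a t' q)
    (h' : ∀ Γ a q, Graded Γ a r q → Graded Γ a r' q) {Γ : Ctx S} {a : S} {q : QTy S}
    (ht : Graded Γ a (.add t r) q) : Graded Γ a (.add t' r') q := by
  refine ht.transfer ?_
  rintro Γ q ⟨q₁, q₂, ht, hr, rfl⟩
  exact .addI (h _ _ _ ht) (h' _ _ _ hr)

end Graded

/-! ### Subject reduction -/

theorem ACEq.graded_iff {t t' : Term S} (h : ACEq t t') (Γ : Ctx S) (a : S) (q : QTy S) :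
    Graded Γ a t q ↔ Graded Γ a t' q := by
  induction h generalizing Γ a q with
  | comm t r =>
    have key : ∀ t r : Term S, Graded Γ a (.add t r) q → Graded Γ a (.add r t) q := by
      intro t r h
      refine h.transfer ?_
      rintro Γ q ⟨q₁, q₂, ht, hr, rfl⟩
      exact (hr.addI ht).congr rfl (add_comm _ _)
    exact ⟨key t r, key r t⟩
  | assoc t r u =>
    constructor <;> intro h <;> refine h.transfer ?_
    · rintro Γ q ⟨q₁, q₂, ht, hr, rfl⟩
      obtain ⟨q₂, q₃, rfl, hr, hu⟩ := hr.exists_of_add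
      exact ((ht.addI hr).addI hu).congr rfl (add_assoc _ _ _)
    · rintro Γ q ⟨q₁, q₂, ht, hu, rfl⟩
      obtain ⟨q₁, q₃, rfl, ht, hr⟩ := ht.exists_of_add
      exact (ht.addI (hr.addI hu)).congr rfl (add_assoc _ _ _).symm
  | refl t => rfl
  | symm _ ih => exact (ih Γ a q).symm
  | trans _ _ ih₁ ih₂ => exact (ih₁ Γ a q).trans (ih₂ Γ a q)
  | lam _ ih => exact ⟨.lam_congr fun Γ a q => (ih Γ a q).1, .lam_congr fun Γ a q => (ih Γ a q).2⟩
  | app _ _ ih₁ ih₂ =>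
    exact ⟨.app_congr (fun Γ a q => (ih₁ Γ a q).1) fun Γ a q => (ih₂ Γ a q).1,
      .app_congr (fun Γ a q => (ih₁ Γ a q).2) fun Γ a q => (ih₂ Γ a q).2⟩
  | smul b _ ih =>
    exact ⟨.smul_congr fun Γ a q => (ih Γ a q).1, .smul_congr fun Γ a q => (ih Γ a q).2⟩
  | add _ _ ih₁ ih₂ =>
    exact ⟨.add_congr (fun Γ a q => (ih₁ Γ a q).1) fun Γ a q => (ih₂ Γ a q).1,
      .add_congr (fun Γ a q => (ih₁ Γ a q).2) fun Γ a q => (ih₂ Γ a q).2⟩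

theorem Step.graded {t t' : Term S} (hstep : Step t t') {Γ : Ctx S} {a : S} {q : QTy S}
    (h : Graded Γ a t q) : Graded Γ a t' q := by
  induction hstep generalizing Γ a q with
  | one_smul t => exact h.of_smul.congr (mul_one a) rfl
  | smul_smul b b' t =>
    refine h.transfer ?_
    intro Γ q ht
    exact .smulI (Graded.of_smul ht)
  | smul_add b t r =>
    refine h.transfer ?_
    intro Γ q ht
    obtain ⟨q₁, q₂, rfl, ht, hr⟩ := Graded.exists_of_add ht
    exact .addI (.smulI ht) (.smulI hr)
  | factor b b' t =>
    refine h.transfer ?_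
    rintro Γ q ⟨q₁, q₂, h₁, h₂, rfl⟩
    exact .smulI ((h₁.of_smul.add h₂.of_smul).congr (by rw [one_mul, one_mul]) rfl)
  | factor_one b t =>
    refine h.transfer ?_
    rintro Γ q ⟨q₁, q₂, h₁, h₂, rfl⟩
    exact .smulI ((h₁.of_smul.add h₂).congr (by rw [one_mul]) rfl)
  | factor_one_one t =>
    refine h.transfer ?_
    rintro Γ q ⟨q₁, q₂, h₁, h₂, rfl⟩
    exact .smulI (h₁.add h₂)
  | beta t b hb => exact h.beta hb
  | add_app t r u =>
    refine h.transfer ?_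
    rintro Γ q ⟨ι, κ, c, d, ks, U, T, A, hA, htr, hu, rfl⟩
    obtain ⟨q₁, q₂, hq, ht, hr⟩ := htr.exists_of_add
    obtain ⟨c₁, c₂, rfl, rfl, hc⟩ := Comb.exists_eval_of_add_eq (M := QTy S) hq.symm
    rw [hc]
    exact .addI (.arrowE c₁ d ks U T A hA ht hu) (.arrowE c₂ d ks U T A hA hr hu)
  | app_add t r u =>
    refine h.transfer ?_
    rintro Γ q ⟨ι, κ, c, d, ks, U, T, A, hA, ht, hru, rfl⟩
    obtain ⟨q₁, q₂, hq, hr, hu⟩ := hru.exists_of_add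
    obtain ⟨d₁, d₂, rfl, rfl, hd⟩ := Comb.exists_eval_of_add_eq (M := QTy S) hq.symm
    simp only [hd, Comb.eval_add]
    exact .addI (.arrowE c d₁ ks U T A hA ht hr) (.arrowE c d₂ ks U T A hA ht hu)
  | smul_app b t r =>
    refine h.transfer ?_
    rintro Γ q ⟨ι, κ, c, d, ks, U, T, A, hA, ht, hr, rfl⟩
    exact .smulI (.app_left hA (ht.of_smul.congr (one_mul b) rfl) hr)
  | app_smul b t r =>
    refine h.transfer ?_
    rintro Γ q ⟨ι, κ, c, d, ks, U, T, A, hA, ht, hr, rfl⟩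
    exact .smulI (.app_right hA ht (hr.of_smul.congr (one_mul b) rfl))
  | ctx_smul b _ ih => exact h.smul_congr fun _ _ _ => ih
  | ctx_add u _ ih => exact h.add_congr (fun _ _ _ => id) fun _ _ _ => ih
  | ctx_app_right u _ ih => exact h.app_congr (fun _ _ _ => id) fun _ _ _ => ih
  | ctx_app_left u _ ih => exact h.app_congr (fun _ _ _ => ih) fun _ _ _ => id
  | ctx_lam _ ih => exact h.lam_congr fun _ _ _ => ih

end

end LvecR

theorem mainTheorem1 {S : Type*} [CommRing S] (t t' : LvecR.Term S) (Γ : LvecR.Ctx S)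
    (T : LvecR.Ty S LvecR.Sort2.gen) (hred : LvecR.Red t t') (ht : LvecR.Typing Γ t T) :
    LvecR.Typing Γ t' T := by
  obtain ⟨s, s', h₁, hstep, h₂⟩ := hred
  exact ((h₂.graded_iff _ _ _).1 (hstep.graded ((h₁.graded_iff _ _ _).1 ht.graded))).typing
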